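/- **Model.** An entanglement generation switch (EGS) serves a finite set $S$ of communication sessions with $R\in\mathbb N$ resources. In each time slot session $s$ may be allocated at most $x_s\in\{1,\dots,R\}$ resources, and each resource allocated to a session for one slot produces, independently, one entangled pair with probability $p_{\mathrm{gen}}\in[0,1]$. Session $s$ has a target rate $\lambda_s\ge 0$; in slot $n$ it submits $a_s(n)\sim\mathrm{Bernoulli}(\lambda_s-\lfloor\lambda_s\rfloor)+\lfloor\lambda_s\rfloor$ demands, independently over sessions and slots. A scheduling policy chooses in every slot $n$ a schedule $M(n)\in\mathbb N^{S}$ with $M_s(n)\le x_s$ for all $s$ and $\sum_s M_s(n)\le R$, as a (possibly randomized) function of everything that happened before; then $g_s(n)\sim\mathrm{Bin}(M_s(n),p_{\mathrm{gen}})$ pairs are generated and the queues evolve by $q_s(n+1)=[q_s(n)+a_s(n)-g_s(n)]^+$ from an arbitrary finite initial queue vector $q(0)\in\mathbb N^S$. Write $|q(n)|=\sum_s q_s(n)$. A policy *supports* $\lambda$ if, for every initial queue vector, $$\lim_{Q\to\infty}\ \limsup_{n\to\infty}\ P\big(|q(n)|\ge Q\big)=0 .$$ The *capacity region* is the set of rate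 vectors $\lambda$ (with $\lambda_s>0$ for every session $s$) that are supported by some policy. A policy is *throughput optimal* if it supports every rate vector of the capacity region. *Maximum Weight Scheduling* selects in every slot a schedule $M$ that maximizes $\sum_s \tilde q_s M_s$ among all $M\in\mathbb N^S$ with $M_s\le\min(\tilde q_s,x_s)$ for all $s$ and $\sum_s M_s\le\min(\sum_s\tilde q_s,R)$, with any (possibly random) tie-breaking; here $\tilde q$ is the queue vector at the start of the previous slot, in which the schedule is computed (in the initial slot, $\tilde q=q(0)$). The results below hold equally if $\tilde q$ is instead the queue vector at the start of the slot itself. **Theorem (Capacity Region).** Let $$\mathcal C=\Big\{\lambda\in\mathbb R^{S}:\ \lambda_s\ge 0\ \text{and}\ \lambda_s\le x_s\,p_{\mathrm{gen}}\ \text{for all } s,\ \ \sum_s\lambda_s\le R\,p_{\mathrm{gen}}\Big\}.$$ 1. If $p_{\mathrm{gen}}<1$, the capacity region of the EGS is the interior of $\mathcal C$. 2. If $\lambda\ge 0$ and $\lambda\notin\mathcal C$, then under every scheduling policy and from every initial queue vector $|q(n)|\to\infty$ almost surely; in particular the limit displayed above is not $0$, and no policy supports $\lambda$. 3. Maximum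 Weight Scheduling policies exist, and each of them supports every $\lambda$ for which $(1+\varepsilon)\lambda\in\mathcal C$ for some $\varepsilon>0$. In particular each supports every $\lambda$ in the interior of $\mathcal C$, and, if $p_{\mathrm{gen}}<1$, is throughput optimal. (Parts 2 and 3 include $p_{\mathrm{gen}}=1$.) -/

import Mathlib

open MeasureTheory ProbabilityTheory Filter Topology

noncomputable section

/-- The parameters of an entanglement generation switch serving the (finite) set `S` of
communication sessions: the number `R` of resources, the maximum number `x s ∈ {1, …, R}` of
resources that session `s` may be allocated in one time slot, and the success probability
`pgen ∈ [0, 1]` of one resource allocated for one time slot. -/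
structure EGS (S : Type*) where
  R : ℕ
  x : S → ℕ
  one_le_x : ∀ s, 1 ≤ x s
  x_le_R : ∀ s, x s ≤ R
  pgen : unitInterval

namespace EGS

variable {S : Type*} [Fintype S]

/-- The set `𝒞` of rate vectors. -/
def rateSet (E : EGS S) : Set (S → ℝ) :=
  {lam | (∀ s, 0 ≤ lam s) ∧ ∑ s, lam s ≤ E.R * (E.pgen : ℝ) ∧
    ∀ s, lam s ≤ E.x s * (E.pgen : ℝ)}

/-- `M` respects the resource constraints: at most `x s` resources for session `s`, and at most
`R` resources in total. -/
def IsAllocation (E : EGS S) (M : S → ℕ) : Prop :=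
  (∀ s, M s ≤ E.x s) ∧ ∑ s, M s ≤ E.R

/-- `M` is a feasible demand based schedule for the queue vector `q`. -/
def IsDemandBased (E : EGS S) (q M : S → ℕ) : Prop :=
  (∀ s, M s ≤ E.x s) ∧ ∑ s, M s ≤ min (∑ s, q s) E.R ∧ ∀ s, M s ≤ min (q s) (E.x s)

/-- `M` is a maximum weight schedule for the queue vector `q`. -/
def IsMaxWeightSchedule (E : EGS S) (q M : S → ℕ) : Prop :=
  E.IsDemandBased q M ∧ ∀ M', E.IsDemandBased q M' → ∑ s, q s * M' s ≤ ∑ s, q s * M s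

/-- What happened in one time slot: the queue vector at its start, the schedule in force, the
demands that arrived, and the numbers of entangled pairs generated. -/
structure Record (S : Type*) where
  queue : S → ℕ
  sched : S → ℕ
  arrivals : S → ℕ
  generated : S → ℕ

/-- A scheduling policy, possibly randomized and history dependent. `sched q h u` is the schedule
in force in the current slot, where `q` is the current queue vector, `h` lists the records of all
previous slots (most recent first), and `u` is a fresh uniform random number in `[0, 1]`. -/
structure Policy (E : EGS S) where
  sched : (S → ℕ) → List (Record S) → unitInterval → S → ℕ
  isAllocation : ∀ q h u, E.IsAllocation (sched q h u)
  measurable_sched : ∀ q h, Measurable (sched q h)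

/-- The queue vector that maximum weight scheduling looks at. If `delayed = true`, the schedule of
a slot has been computed during the previous slot, from the queue vector at the start of that
previous slot (the schedule of the initial slot is computed from the initial queue vector). If
`delayed = false`, it is computed from the queue vector at the start of the slot itself. -/
def observedQueue (delayed : Bool) (q : S → ℕ) (h : List (Record S)) : S → ℕ :=
  match delayed, h with
  | true, r :: _ => r.queue
  | _, _ => q

/-- The policy always selects a maximum weight schedule; ties are broken in any (possibly random)
way. -/
def Policy.IsMaxWeight {E : EGS S} (delayed : Bool) (π : E.Policy) : Prop :=
  ∀ q h u, E.IsMaxWeightSchedule (observedQueue delayed q h) (π.sched q h u)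

/-- The randomness of one slot: the random number available to the scheduling policy, the numbers
of arriving demands, and, for each session `s` and `k < R`, whether the `k`-th resource allocated
to `s` (if there is one) succeeds. -/
abbrev Noise (E : EGS S) : Type _ :=
  unitInterval × (S → ℕ) × (S → Fin E.R → Bool)

/-- The law `Bernoulli(r - ⌊r⌋) + ⌊r⌋` of the number of demands submitted in one slot by a session
with target rate `r ≥ 0`. -/
def arrivalLaw (r : ℝ) : Measure ℕ :=
  bernoulliMeasure (⌊r⌋₊ + 1) ⌊r⌋₊ ⟨Int.fract r, Int.fract_nonneg r, (Int.fract_lt_one r).le⟩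

/-- The law of the randomness of one slot: all its components are independent. -/
def slotLaw (E : EGS S) (lam : S → ℝ) : Measure E.Noise :=
  (volume : Measure unitInterval).prod
    ((Measure.pi fun s => arrivalLaw (lam s)).prod
      (Measure.pi fun _ : S => Measure.pi fun _ : Fin E.R => bernoulliMeasure true false E.pgen))

/-- The law of the whole randomness: the slots are independent and identically distributed. -/
def law (E : EGS S) (lam : S → ℝ) : Measure (ℕ → E.Noise) :=
  Measure.infinitePi fun _ => E.slotLaw lam

/-- The numbers of successes among the resources allocated by the schedule `M`. Under `slotLaw`
and for `M ≤ R` they are independent, with law `Bin (M s, pgen)` for session `s`. -/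
def successes (E : EGS S) (M : S → ℕ) (b : S → Fin E.R → Bool) : S → ℕ :=
  fun s => (Finset.univ.filter fun k : Fin E.R => (k : ℕ) < M s ∧ b s k = true).card

/-- The queue vector at the start of slot `n`, with the records of the slots before `n`. The
subtraction is the truncated one of `ℕ`, so the new queue is `max (q + a - g) 0`. -/
def run {E : EGS S} (π : E.Policy) (q₀ : S → ℕ) (ω : ℕ → E.Noise) :
    ℕ → (S → ℕ) × List (Record S)
  | 0 => (q₀, [])
  | n + 1 =>
    let q := (run π q₀ ω n).1
    let h := (run π q₀ ω n).2
    let M := π.sched q h (ω n).1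
    let a := (ω n).2.1
    let g := E.successes M (ω n).2.2
    (fun s => q s + a s - g s, ⟨q, M, a, g⟩ :: h)

/-- The total queue length at the start of slot `n`. -/
def totalQueue {E : EGS S} (π : E.Policy) (q₀ : S → ℕ) (ω : ℕ → E.Noise) (n : ℕ) : ℕ :=
  ∑ s, (run π q₀ ω n).1 s

/-- Started from the queue vector `q₀`, the policy `π` keeps the queues stable at the arrival rate
vector `lam`: `lim_{Q → ∞} limsup_{n → ∞} P (|q(n)| ≥ Q) = 0`. -/
def StableFrom {E : EGS S} (π : E.Policy) (lam : S → ℝ) (q₀ : S → ℕ) : Prop :=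
  Tendsto
    (fun Q : ℕ => limsup (fun n : ℕ => E.law lam {ω | Q ≤ totalQueue π q₀ ω n}) atTop)
    atTop (𝓝 0)

/-- The policy `π` supports the rate vector `lam`, whatever the (finite) initial queues are. -/
def Policy.Supports {E : EGS S} (π : E.Policy) (lam : S → ℝ) : Prop :=
  ∀ q₀ : S → ℕ, StableFrom π lam q₀

/-- The capacity region: the vectors of target rates supported by some scheduling policy. By
definition a communication session has a positive target rate. -/
def capacityRegion (E : EGS S) : Set (S → ℝ) :=
  {lam | (∀ s, 0 < lam s) ∧ ∃ π : E.Policy, π.Supports lam}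

/-- The policy `π` is throughput optimal: it supports every rate vector that can be supported. -/
def Policy.IsThroughputOptimal {E : EGS S} (π : E.Policy) : Prop :=
  ∀ lam ∈ E.capacityRegion, π.Supports lam

end EGS

end

/-!
The three parts rest on one fact about the model: the state of the queues at the start of slot `n`
is a function of the randomness of the earlier slots, so slot `n` may be resampled
(`measurePreserving_update`). This turns bounds on one slot, for a fixed state and a fixed schedule,
into bounds on expectations (`lintegral_run_succ_le`, `integral_eq_integral_update`), for arbitrary
history dependent and randomized policies, and no theory of Markov chains is needed.

*Outside the rate set.* A bottleneck is a set `T` of sessions that no allocation can give more than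
`c` resources: a single session with `c = x s`, or all sessions with `c = R`. If `lam` is not in the
rate set, some bottleneck is overloaded, `pgen * c < ∑ s ∈ T, lam s`. The number `|q|` of demands
queued there has positive drift and bounded increments, so for a small `θ > 0` the expectation of
`exp (-θ |q|)` decays geometrically. Hence the sum of these variables over all slots is almost
surely finite and `|q| → ∞` (`ae_tendsto_of_isBottleneck_lt`).

*On the boundary.* A positive vector of the rate set outside its interior puts load exactly one on
some bottleneck. Filling up each schedule so that the bottleneck uses `c` resources in every slot
gives a lower bound for `|q|` by a martingale with bounded increments whose conditional variances
are bounded below, because `0 < pgen < 1`. Its second and fourth moments are of order `n` and `n²`,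
and a Paley–Zygmund type inequality (`exists_le_measureReal_ge`) shows that it exceeds a multiple of
`√n` with probability bounded away from zero; so no policy is stable
(`not_stableFrom_of_isBottleneck_eq`).

*Maximum weight scheduling.* If `(1 + ε) • lam` is in the rate set and `0 < pgen`, all components of
`lam` can be increased by some `δ > 0` within the rate set. The linear program behind the schedule
has integral optima (`sum_mul_le_of_forall_nat`), so a maximum weight schedule has, up to a
constant, at least the weight of the real allocation `(lam + δ) / pgen`; the restriction to demand
based schedules and the delay of one slot change the weight only by a constant. Therefore the
Euclidean norm of the queue vector has negative drift when it is large, its exponential moments are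
bounded uniformly in time (`exists_exp_queueNorm_drift`), and stability follows from Markov's
inequality (`Policy.IsMaxWeight.supports`). If `pgen = 0`, then `lam = 0` and the queues cannot
grow.
-/

noncomputable section

namespace EGS

/-! ### The randomness of one slot -/

section

variable {S : Type*} (E : EGS S)

lemma successes_le_R (M : S → ℕ) (b : S → Fin E.R → Bool) (s : S) :
    E.successes M b s ≤ E.R :=
  (Finset.card_filter_le _ _).trans (by simp)

lemma successes_mono {M M' : S → ℕ} {s : S} (h : M s ≤ M' s) (b : S → Fin E.R → Bool) :
    E.successes M b s ≤ E.successes M' b s := by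
  refine Finset.card_le_card fun k hk => ?_
  simp only [Finset.mem_filter, Finset.mem_univ, true_and] at hk ⊢
  exact ⟨hk.1.trans_le h, hk.2⟩

variable [Fintype S]

/-- The randomness of one slot that the scheduling policy does not see: the arriving demands and
the outcomes of the generation attempts. -/
abbrev Draw : Type _ :=
  (S → ℕ) × (S → Fin E.R → Bool)

/-- The law of a `Draw`; `slotLaw` is its product with the uniform law on `[0, 1]`. -/
def drawLaw (lam : S → ℝ) : Measure E.Draw :=
  (Measure.pi fun s => arrivalLaw (lam s)).prod
    (Measure.pi fun _ : S => Measure.pi fun _ : Fin E.R => bernoulliMeasure true false E.pgen)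

instance (r : ℝ) : IsProbabilityMeasure (arrivalLaw r) := by
  unfold arrivalLaw; infer_instance

instance (lam : S → ℝ) : IsProbabilityMeasure (E.drawLaw lam) := by
  unfold drawLaw; infer_instance

lemma slotLaw_eq (lam : S → ℝ) :
    E.slotLaw lam = (volume : Measure unitInterval).prod (E.drawLaw lam) := rfl

instance (lam : S → ℝ) : IsProbabilityMeasure (E.slotLaw lam) := by
  rw [slotLaw_eq]; infer_instance

instance (lam : S → ℝ) : IsProbabilityMeasure (E.law lam) := by
  unfold law; infer_instance

lemma ae_le_arrivalLaw (r : ℝ) : ∀ᵐ k ∂(arrivalLaw r), k ≤ ⌊r⌋₊ + 1 := by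
  rw [ae_iff]
  exact bernoulliMeasure_apply_of_notMem_of_notMem _ (MeasurableSet.of_discrete) (by simp) (by simp)

lemma integral_arrivalLaw {r : ℝ} (hr : 0 ≤ r) : ∫ k, (k : ℝ) ∂(arrivalLaw r) = r := by
  have h1 : (⌊r⌋₊ : ℝ) = ⌊r⌋ := natCast_floor_eq_intCast_floor hr
  have h2 := Int.floor_add_fract r
  rw [arrivalLaw, integral_bernoulliMeasure]
  simp only [smul_eq_mul]
  push_cast
  rw [h1]
  linarith

variable (lam : S → ℝ)

lemma ae_arrivals_le : ∀ᵐ d ∂(E.drawLaw lam), ∀ s, d.1 s ≤ ⌊lam s⌋₊ + 1 := by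
  rw [ae_all_iff]
  intro s
  have h : MeasurePreserving (fun d : E.Draw => d.1 s) (E.drawLaw lam) (arrivalLaw (lam s)) :=
    (measurePreserving_eval (fun s => arrivalLaw (lam s)) s).comp measurePreserving_fst
  exact h.quasiMeasurePreserving.ae (ae_le_arrivalLaw _)

lemma integral_arrivals {lam : S → ℝ} (s : S) (h0 : 0 ≤ lam s) :
    ∫ d, (d.1 s : ℝ) ∂(E.drawLaw lam) = lam s := by
  have h : MeasurePreserving (fun d : E.Draw => d.1 s) (E.drawLaw lam) (arrivalLaw (lam s)) :=
    (measurePreserving_eval (fun s => arrivalLaw (lam s)) s).comp measurePreserving_fst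
  rw [← integral_arrivalLaw h0, ← h.map_eq, integral_map h.measurable.aemeasurable]
  exact (measurable_of_countable _).aestronglyMeasurable

lemma measurePreserving_coin (s : S) (k : Fin E.R) :
    MeasurePreserving (fun d : E.Draw => d.2 s k) (E.drawLaw lam)
      (bernoulliMeasure true false E.pgen) :=
  (measurePreserving_eval (fun _ : Fin E.R => bernoulliMeasure true false E.pgen) k).comp
    ((measurePreserving_eval (fun _ : S => Measure.pi fun _ : Fin E.R =>
      bernoulliMeasure true false E.pgen) s).comp measurePreserving_snd)

lemma card_fin_lt {n m : ℕ} (h : m ≤ n) :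
    (Finset.univ.filter fun k : Fin n => (k : ℕ) < m).card = m := by
  rw [Fin.card_filter_val_lt]
  omega

lemma integral_successes {M : S → ℕ} {s : S} (hM : M s ≤ E.R) :
    ∫ d, (E.successes M d.2 s : ℝ) ∂(E.drawLaw lam) = E.pgen * M s := by
  have hcoin : ∀ k : Fin E.R,
      ∫ d, (if d.2 s k = true then (1 : ℝ) else 0) ∂(E.drawLaw lam) = E.pgen := by
    intro k
    have h := measurePreserving_coin E lam s k
    have := integral_map (μ := E.drawLaw lam) h.measurable.aemeasurable
      (f := fun b : Bool => if b = true then (1 : ℝ) else 0)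
      (measurable_of_countable _).aestronglyMeasurable
    rw [← this, h.map_eq, integral_bernoulliMeasure]
    simp
  have hsum : ∀ d : E.Draw, (E.successes M d.2 s : ℝ) =
      ∑ k ∈ Finset.univ.filter (fun k : Fin E.R => (k : ℕ) < M s),
        if d.2 s k = true then (1 : ℝ) else 0 := by
    intro d
    rw [successes, ← Finset.filter_filter, Finset.card_filter]
    push_cast
    rfl
  simp_rw [hsum]
  rw [integral_finsetSum]
  · simp_rw [hcoin]
    rw [Finset.sum_const, card_fin_lt hM, nsmul_eq_mul, mul_comm]
  · intro k _
    refine Integrable.of_bound (C := 1) (measurable_of_countable _).aestronglyMeasurable ?_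
    exact Eventually.of_forall fun d => by split_ifs <;> simp

/-- The net number of demands `a s - g s` that one slot adds to queue `s` before truncation. -/
def netInput (M : S → ℕ) (d : E.Draw) (s : S) : ℝ :=
  (d.1 s : ℝ) - (E.successes M d.2 s : ℝ)

/-- An almost sure bound for the change of one queue in one slot. -/
def inputBound : ℝ :=
  ∑ s, ((⌊lam s⌋₊ : ℝ) + 1) + E.R + 1

lemma one_le_inputBound : 1 ≤ E.inputBound lam := by
  unfold inputBound
  have : 0 ≤ ∑ s, ((⌊lam s⌋₊ : ℝ) + 1) := Finset.sum_nonneg fun s _ => by positivity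
  have : (0 : ℝ) ≤ E.R := by positivity
  linarith

lemma add_le_inputBound (s : S) : ((⌊lam s⌋₊ : ℝ) + 1) + E.R ≤ E.inputBound lam := by
  unfold inputBound
  have := Finset.single_le_sum (f := fun s => (⌊lam s⌋₊ : ℝ) + 1)
    (fun s _ => by positivity) (Finset.mem_univ s)
  linarith

lemma abs_netInput_le (M : S → ℕ) {d : E.Draw} {s : S} (hd : d.1 s ≤ ⌊lam s⌋₊ + 1) :
    |E.netInput M d s| ≤ E.inputBound lam := by
  have h1 := E.add_le_inputBound lam s
  have h2 : (d.1 s : ℝ) ≤ ⌊lam s⌋₊ + 1 := by exact_mod_cast hd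
  have h3 : (E.successes M d.2 s : ℝ) ≤ E.R := by exact_mod_cast E.successes_le_R M d.2 s
  have h4 : (0 : ℝ) ≤ E.successes M d.2 s := by positivity
  have h5 : (0 : ℝ) ≤ d.1 s := by positivity
  have h6 : (0 : ℝ) ≤ ⌊lam s⌋₊ := by positivity
  rw [netInput, abs_le]
  constructor <;> linarith

lemma integrable_netInput (M : S → ℕ) (s : S) :
    Integrable (fun d => E.netInput M d s) (E.drawLaw lam) := by
  refine Integrable.of_bound (C := E.inputBound lam)
    (measurable_of_countable _).aestronglyMeasurable ?_
  filter_upwards [E.ae_arrivals_le lam] with d hd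
  exact E.abs_netInput_le lam M (hd s)

lemma integral_netInput {lam : S → ℝ} {M : S → ℕ} {s : S} (h0 : 0 ≤ lam s) (hM : M s ≤ E.R) :
    ∫ d, E.netInput M d s ∂(E.drawLaw lam) = lam s - E.pgen * M s := by
  unfold netInput
  rw [integral_sub, integral_arrivals E s h0, integral_successes E lam hM]
  · refine Integrable.of_bound (C := (⌊lam s⌋₊ : ℝ) + 1)
      (measurable_of_countable _).aestronglyMeasurable ?_
    filter_upwards [E.ae_arrivals_le lam] with d hd
    rw [Real.norm_of_nonneg (by positivity)]
    exact_mod_cast hd s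
  · refine Integrable.of_bound (C := E.R)
      (measurable_of_countable _).aestronglyMeasurable (Eventually.of_forall fun d => ?_)
    rw [Real.norm_of_nonneg (by positivity)]
    exact_mod_cast E.successes_le_R M d.2 s

/-- A lower bound for the second moment of the net input. With `N` generation attempts, all of
them succeed with probability `pgen ^ N`, and all fail with probability `(1 - pgen) ^ N`;
whatever the arrivals are, the net input is a nonzero integer in one of the two cases. -/
lemma le_integral_sq_sum_netInput {M : S → ℕ} (T : Finset S) (hM : ∀ s, M s ≤ E.R)
    (hT : 1 ≤ ∑ s ∈ T, M s) :
    min ((E.pgen : ℝ) ^ (Fintype.card S * E.R)) ((1 - E.pgen : ℝ) ^ (Fintype.card S * E.R)) ≤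
      ∫ d, (∑ s ∈ T, E.netInput M d s) ^ 2 ∂(E.drawLaw lam) := by
  classical
  set N := Fintype.card S * E.R
  set v := min ((E.pgen : ℝ) ^ N) ((1 - E.pgen : ℝ) ^ N)
  set ν := Measure.pi fun _ : S => Measure.pi fun _ : Fin E.R => bernoulliMeasure true false E.pgen
  have hp0 : (0 : ℝ) ≤ E.pgen := E.pgen.2.1
  have hp1 : (E.pgen : ℝ) ≤ 1 := E.pgen.2.2
  have hcoins : ∀ β : Bool, v ≤ ν.real {fun _ _ => β} := by
    intro β
    have : ν.real {fun _ _ => β} = ((bernoulliMeasure true false E.pgen).real {β}) ^ N := by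
      simp only [ν, Measure.real]
      rw [Measure.pi_singleton]
      simp only [Measure.pi_singleton, Finset.prod_const, Finset.card_univ, Fintype.card_fin, N]
      rw [← pow_mul, ENNReal.toReal_pow, mul_comm]
    rw [this]
    cases β
    · rw [bernoulliMeasure_real_apply_of_notMem_of_mem _ (by simp) (by simp) (by simp)]
      exact min_le_right _ _
    · rw [bernoulliMeasure_real_apply_of_mem_of_notMem _ (by simp) (by simp) (by simp)]
      exact min_le_left _ _
  have hv0 : 0 ≤ v := le_min (by positivity) (pow_nonneg (by linarith) _)
  have hbound : ∀ᵐ d ∂(E.drawLaw lam),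
      ‖(∑ s ∈ T, E.netInput M d s) ^ 2‖ ≤ (T.card * E.inputBound lam) ^ 2 := by
    filter_upwards [E.ae_arrivals_le lam] with d hd
    rw [norm_pow]
    gcongr
    refine (Finset.abs_sum_le_sum_abs _ _).trans ?_
    rw [← nsmul_eq_mul]
    exact Finset.sum_le_card_nsmul _ _ _ fun s _ => E.abs_netInput_le lam M (hd s)
  have hint : Integrable (fun d => (∑ s ∈ T, E.netInput M d s) ^ 2) (E.drawLaw lam) :=
    Integrable.of_bound (measurable_of_countable _).aestronglyMeasurable _ hbound
  have hall : ∀ s, E.successes M (fun _ _ => true) s = M s := fun s => by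
    simp [successes, card_fin_lt (hM s)]
  have hnone : ∀ s, E.successes M (fun _ _ => false) s = 0 := fun s => by
    simp [successes]
  have hinner : ∀ᵐ a ∂(Measure.pi fun s => arrivalLaw (lam s)),
      v ≤ ∫ b, (∑ s ∈ T, E.netInput M (a, b) s) ^ 2 ∂ν := by
    unfold drawLaw at hint
    filter_upwards [hint.prod_right_ae] with a ha
    -- an integer differs by at least one from `0` or from `∑ s ∈ T, M s`
    obtain ⟨β, hβ⟩ : ∃ β : Bool, 1 ≤ (∑ s ∈ T, E.netInput M (a, fun _ _ => β) s) ^ 2 := by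
      by_cases ha0 : ∑ s ∈ T, a s = 0
      · refine ⟨true, ?_⟩
        have h1 : (∑ s ∈ T, E.netInput M (a, fun _ _ => true) s) = -((∑ s ∈ T, M s : ℕ) : ℝ) := by
          simp only [netInput, hall, Finset.sum_sub_distrib]
          rw [← Nat.cast_sum, ha0]
          push_cast
          ring
        have h2 : (1 : ℝ) ≤ ((∑ s ∈ T, M s : ℕ) : ℝ) := by exact_mod_cast hT
        rw [h1]
        nlinarith
      · refine ⟨false, ?_⟩
        have h1 : (∑ s ∈ T, E.netInput M (a, fun _ _ => false) s) = ((∑ s ∈ T, a s : ℕ) : ℝ) := by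
          simp only [netInput, hnone]
          push_cast
          simp
        have h2 : (1 : ℝ) ≤ ((∑ s ∈ T, a s : ℕ) : ℝ) := by
          exact_mod_cast Nat.one_le_iff_ne_zero.2 ha0
        rw [h1]
        nlinarith
    calc v ≤ ν.real {fun _ _ => β} := hcoins β
      _ = ∫ b, Set.indicator {fun _ _ => β} (fun _ => (1 : ℝ)) b ∂ν := by
          rw [integral_indicator_const _ (MeasurableSet.singleton _), smul_eq_mul, mul_one]
      _ ≤ _ := by
          refine integral_mono ((integrable_const _).indicator (MeasurableSet.singleton _)) ha ?_
          intro b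
          by_cases hb : b = fun _ _ => β
          · subst hb
            simpa using hβ
          · simp only [Set.indicator, Set.mem_singleton_iff, hb, if_false]
            positivity
  have := hint
  unfold drawLaw at this ⊢
  rw [integral_prod _ this]
  calc v = ∫ _, v ∂(Measure.pi fun s => arrivalLaw (lam s)) := by simp
    _ ≤ _ := integral_mono_ae (integrable_const _) this.integral_prod_left hinner

end

/-! ### The queue process and resampling of a slot -/

section

variable {S : Type*} {E : EGS S}

/-- A state of the switch: the queue vector and the records of the previous slots. -/
abbrev State (S : Type*) : Type _ := (S → ℕ) × List (Record S)

instance : MeasurableSpace (Record S) := ⊤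

instance : MeasurableSpace (List (Record S)) := ⊤

instance : DiscreteMeasurableSpace (List (Record S)) := ⟨fun _ => trivial⟩

/-- The state after a slot with schedule `M` and outcome `d`. -/
def next (x : State S) (M : S → ℕ) (d : E.Draw) : State S :=
  (fun s => x.1 s + d.1 s - E.successes M d.2 s, ⟨x.1, M, d.1, E.successes M d.2⟩ :: x.2)

variable [Fintype S]

/-- The schedule that the policy `π` chooses in the state `x`. -/
def Policy.schedAt (π : E.Policy) (x : State S) (u : unitInterval) : S → ℕ :=
  π.sched x.1 x.2 u

/-- One slot of the queue process under the policy `π`. -/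
def step (π : E.Policy) (x : State S) (z : E.Noise) : State S :=
  next x (π.schedAt x z.1) z.2

lemma run_succ (π : E.Policy) (q₀ : S → ℕ) (ω : ℕ → E.Noise) (n : ℕ) :
    run π q₀ ω (n + 1) = step π (run π q₀ ω n) (ω n) := rfl

lemma run_congr (π : E.Policy) (q₀ : S → ℕ) {ω ω' : ℕ → E.Noise} {n : ℕ}
    (h : ∀ k < n, ω k = ω' k) : run π q₀ ω n = run π q₀ ω' n := by
  induction n with
  | zero => rfl
  | succ n ih =>
    rw [run_succ, run_succ, ih fun k hk => h k (hk.trans n.lt_succ_self), h n n.lt_succ_self]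

lemma run_update (π : E.Policy) (q₀ : S → ℕ) (ω : ℕ → E.Noise) {k n : ℕ} (h : k ≤ n)
    (z : E.Noise) : run π q₀ (Function.update ω n z) k = run π q₀ ω k :=
  run_congr π q₀ fun _ hj => Function.update_of_ne (hj.trans_le h).ne _ _

lemma run_update_succ (π : E.Policy) (q₀ : S → ℕ) (ω : ℕ → E.Noise) (n : ℕ)
    (z : E.Noise) :
    run π q₀ (Function.update ω n z) (n + 1) = step π (run π q₀ ω n) z := by
  rw [run_succ, run_update π q₀ ω le_rfl, Function.update_self]

instance : Countable (Record S) := by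
  have : Function.Injective
      fun r : Record S => (r.queue, r.sched, r.arrivals, r.generated) := by
    rintro ⟨a, b, c, d⟩ ⟨a', b', c', d'⟩ h
    simp_all
  exact this.countable

instance : DiscreteMeasurableSpace (State S) := MeasurableSingletonClass.toDiscreteMeasurableSpace

lemma measurable_schedAt (π : E.Policy) (x : State S) : Measurable (π.schedAt x) :=
  π.measurable_sched x.1 x.2

/-- A function of the state, the schedule and the outcome of a slot is measurable, as all of these
take countably many values. -/
lemma measurable_comp_schedAt {β : Type*} [MeasurableSpace β] (π : E.Policy)
    (F : State S → (S → ℕ) → E.Draw → β) :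
    Measurable fun p : State S × E.Noise => F p.1 (π.schedAt p.1 p.2.1) p.2.2 := by
  refine measurable_from_prod_countable_right fun x => ?_
  have h1 : Measurable fun z : E.Noise => (π.schedAt x z.1, z.2) :=
    ((measurable_schedAt π x).comp measurable_fst).prodMk measurable_snd
  exact (measurable_of_countable fun y : (S → ℕ) × E.Draw => F x y.1 y.2).comp h1

lemma measurable_run (π : E.Policy) (q₀ : S → ℕ) (n : ℕ) :
    Measurable fun ω => run π q₀ ω n := by
  induction n with
  | zero => exact measurable_const
  | succ n ih =>
    exact (measurable_comp_schedAt π next).comp (ih.prodMk (measurable_pi_apply n))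

variable (lam : S → ℝ)

lemma measurePreserving_update (n : ℕ) :
    MeasurePreserving (fun p : (ℕ → E.Noise) × E.Noise => Function.update p.1 n p.2)
      ((E.law lam).prod (E.slotLaw lam)) (E.law lam) := by
  have hm : Measurable fun p : (ℕ → E.Noise) × E.Noise => Function.update p.1 n p.2 := by
    refine measurable_pi_iff.2 fun k => ?_
    by_cases hk : k = n
    · subst hk
      simpa using measurable_snd
    · simp only [Function.update_of_ne hk]
      exact (measurable_pi_apply k).comp measurable_fst
  refine ⟨hm, ?_⟩
  refine Measure.eq_infinitePi _ fun I t ht => ?_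
  rw [Measure.map_apply hm (MeasurableSet.pi I.countable_toSet fun i _ => ht i)]
  have hI : (fun p : (ℕ → E.Noise) × E.Noise => Function.update p.1 n p.2) ⁻¹' Set.pi (I : Set ℕ) t
      = (Set.pi ((I.erase n : Finset ℕ) : Set ℕ) t) ×ˢ (if n ∈ I then t n else Set.univ) := by
    ext ⟨ω, z⟩
    simp only [Set.mem_preimage, Set.mem_pi, Finset.mem_coe, Set.mem_prod, Finset.mem_erase]
    constructor
    · intro h
      refine ⟨fun i hi => by simpa [Function.update_of_ne hi.1] using h i hi.2, ?_⟩
      split_ifs with hn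
      · simpa using h n hn
      · trivial
    · rintro ⟨h1, h2⟩ i hi
      by_cases hin : i = n
      · subst hin
        simpa [hi] using h2
      · simpa [Function.update_of_ne hin] using h1 i ⟨hin, hi⟩
  rw [hI, Measure.prod_prod, law, Measure.infinitePi_pi _ (fun i _ => ht i)]
  split_ifs with hn
  · exact Finset.prod_erase_mul I (fun i => E.slotLaw lam (t i)) hn
  · rw [measure_univ, mul_one, Finset.erase_eq_of_notMem hn]

/-- Resampling slot `n`: the Markov property of the queue process in integrated form. -/
lemma lintegral_run_succ (π : E.Policy) (q₀ : S → ℕ) (f : State S → ENNReal) (n : ℕ) :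
    ∫⁻ ω, f (run π q₀ ω (n + 1)) ∂(E.law lam) =
      ∫⁻ ω, ∫⁻ u, ∫⁻ d, f (next (run π q₀ ω n) (π.schedAt (run π q₀ ω n) u) d)
        ∂(E.drawLaw lam) ∂(volume : Measure unitInterval) ∂(E.law lam) := by
  have hf : Measurable f := measurable_of_countable f
  have h2 : Measurable fun p : State S × E.Noise => f (step π p.1 p.2) :=
    hf.comp (measurable_comp_schedAt π next)
  refine ((measurePreserving_update lam n).lintegral_comp
    (hf.comp (measurable_run π q₀ (n + 1)))).symm.trans ?_
  simp_rw [Function.comp_apply, run_update_succ]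
  have h3 : Measurable fun p : (ℕ → E.Noise) × E.Noise => f (step π (run π q₀ p.1 n) p.2) :=
    h2.comp (((measurable_run π q₀ n).comp measurable_fst).prodMk measurable_snd)
  rw [lintegral_prod _ h3.aemeasurable]
  refine lintegral_congr fun ω => ?_
  rw [slotLaw_eq]
  exact lintegral_prod (fun z : E.Noise => f (step π (run π q₀ ω n) z))
    (h2.comp measurable_prodMk_left).aemeasurable

/-- A one-step bound for `f` that holds in almost every state and for every schedule propagates
to expectations. -/
lemma lintegral_run_succ_le (π : E.Policy) (q₀ : S → ℕ) {f g : State S → ENNReal} {n : ℕ}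
    (h : ∀ᵐ ω ∂(E.law lam), ∀ u,
      ∫⁻ d, f (next (run π q₀ ω n) (π.schedAt (run π q₀ ω n) u) d) ∂(E.drawLaw lam) ≤
        g (run π q₀ ω n)) :
    ∫⁻ ω, f (run π q₀ ω (n + 1)) ∂(E.law lam) ≤ ∫⁻ ω, g (run π q₀ ω n) ∂(E.law lam) := by
  rw [lintegral_run_succ]
  refine lintegral_mono_ae ?_
  filter_upwards [h] with ω hω
  calc _ ≤ ∫⁻ _ : unitInterval, g (run π q₀ ω n) := lintegral_mono hω
    _ = _ := by simp

lemma ae_forall_arrivals_le :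
    ∀ᵐ ω ∂(E.law lam), ∀ n s, (ω n).2.1 s ≤ ⌊lam s⌋₊ + 1 := by
  rw [ae_all_iff]
  intro n
  have h : MeasurePreserving (fun ω : ℕ → E.Noise => (ω n).2) (E.law lam) (E.drawLaw lam) :=
    measurePreserving_snd.comp (measurePreserving_eval_infinitePi (fun _ => E.slotLaw lam) n)
  exact h.quasiMeasurePreserving.ae (E.ae_arrivals_le lam)

variable {lam}

/-- Bounding the tails of the queue length uniformly in time gives stability. -/
lemma stableFrom_of_tail_le {π : E.Policy} {q₀ : S → ℕ} {f : ℕ → ENNReal}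
    (hf : Tendsto f atTop (𝓝 0))
    (h : ∀ Q n, E.law lam {ω | Q ≤ totalQueue π q₀ ω n} ≤ f Q) : StableFrom π lam q₀ := by
  refine tendsto_of_tendsto_of_tendsto_of_le_of_le tendsto_const_nhds hf (fun _ => bot_le) ?_
  intro Q
  exact limsup_le_of_le (by isBoundedDefault) (Eventually.of_forall fun n => h Q n)

lemma not_stableFrom_of_eventually_le {π : E.Policy} {q₀ : S → ℕ} {c : ENNReal} (hc : 0 < c)
    (h : ∀ Q, ∀ᶠ n in atTop, c ≤ E.law lam {ω | Q ≤ totalQueue π q₀ ω n}) :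
    ¬ StableFrom π lam q₀ := by
  intro hs
  refine absurd (ge_of_tendsto' hs fun Q => ?_) (not_le.2 hc)
  exact le_limsup_of_frequently_le (h Q).frequently (by isBoundedDefault)

lemma measurable_totalQueue (π : E.Policy) (q₀ : S → ℕ) (n : ℕ) :
    Measurable fun ω => totalQueue π q₀ ω n :=
  (measurable_of_countable fun x : State S => ∑ s, x.1 s).comp (measurable_run π q₀ n)

/-- Almost sure divergence of the queues excludes stability. -/
lemma not_stableFrom_of_ae_tendsto {π : E.Policy} {q₀ : S → ℕ}
    (h : ∀ᵐ ω ∂(E.law lam), Tendsto (totalQueue π q₀ ω) atTop atTop) :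
    ¬ StableFrom π lam q₀ := by
  refine not_stableFrom_of_eventually_le (c := 2⁻¹) (by simp) fun Q => ?_
  have h1 : TendstoInMeasure (E.law lam)
      (fun n ω => ((min (totalQueue π q₀ ω n) Q : ℕ) : ℝ)) atTop (fun _ => (Q : ℝ)) := by
    refine tendstoInMeasure_of_tendsto_ae (fun n => ?_) ?_
    · exact ((measurable_of_countable fun k : ℕ => ((min k Q : ℕ) : ℝ)).comp
        (measurable_totalQueue π q₀ n)).aestronglyMeasurable
    · filter_upwards [h] with ω hω
      refine tendsto_const_nhds.congr' ?_
      filter_upwards [hω.eventually_ge_atTop Q] with n hn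
      rw [min_eq_right hn]
  have h2 := h1 1 (by simp)
  have h3 := h2.eventually (gt_mem_nhds (show (0 : ENNReal) < 2⁻¹ by simp))
  filter_upwards [h3] with n hn
  have hsub : {ω | Q ≤ totalQueue π q₀ ω n}ᶜ ⊆
      {ω | 1 ≤ edist ((min (totalQueue π q₀ ω n) Q : ℕ) : ℝ) (Q : ℝ)} := by
    intro ω hω
    simp only [Set.mem_compl_iff, Set.mem_ofPred_eq, not_le] at hω ⊢
    rw [min_eq_left hω.le, edist_dist, Real.dist_eq, ← ENNReal.ofReal_one]
    refine ENNReal.ofReal_le_ofReal ?_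
    have : ((totalQueue π q₀ ω n : ℕ) : ℝ) + 1 ≤ Q := by exact_mod_cast hω
    rw [abs_sub_comm]
    exact le_trans (by linarith) (le_abs_self _)
  have hms : MeasurableSet {ω | Q ≤ totalQueue π q₀ ω n} :=
    measurableSet_le measurable_const (measurable_totalQueue π q₀ n)
  have h4 : E.law lam {ω | Q ≤ totalQueue π q₀ ω n}ᶜ ≤ 2⁻¹ := (measure_mono hsub).trans hn.le
  have h5 := prob_add_prob_compl (μ := E.law lam) hms
  by_contra hlt
  rw [not_le] at hlt
  have := ENNReal.add_lt_add_of_lt_of_le (by finiteness) hlt h4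
  rw [h5, ENNReal.inv_two_add_inv_two] at this
  exact lt_irrefl _ this

end

/-! ### Two moment inequalities -/

section

/-- A bounded random variable with mean at most `-δ` has an exponential moment below `1`, where the
exponent and the bound depend only on `δ` and on the bound of the variable. -/
lemma exists_lintegral_exp_le {Ω : Type*} [MeasurableSpace Ω] (μ : Measure Ω)
    [IsProbabilityMeasure μ] (B : ℝ) {δ : ℝ} (hδ : 0 < δ) :
    ∃ θ : ℝ, 0 < θ ∧ ∃ ρ : ENNReal, ρ < 1 ∧ ∀ X : Ω → ℝ, AEStronglyMeasurable X μ →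
      (∀ᵐ ω ∂μ, |X ω| ≤ B) → ∫ ω, X ω ∂μ ≤ -δ →
      ∫⁻ ω, ENNReal.ofReal (Real.exp (θ * X ω)) ∂μ ≤ ρ := by
  set b := max B 1
  have hb : 0 < b := lt_max_of_lt_right one_pos
  -- `exp (θ X) ≤ 1 + θ X + (θ X)²`, and this `θ` makes the linear term dominate
  set θ := min (1 / b) (δ / (2 * b ^ 2))
  have hθ : 0 < θ := lt_min (by positivity) (by positivity)
  have hθ1 : θ * b ≤ 1 := (le_div_iff₀ hb).1 (min_le_left _ _)
  have hθ2 : θ * (2 * b ^ 2) ≤ δ := (le_div_iff₀ (by positivity)).1 (min_le_right _ _)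
  refine ⟨θ, hθ, ENNReal.ofReal (1 - θ * δ / 2), ?_, fun X hX hB hm => ?_⟩
  · rw [ENNReal.ofReal_lt_one]
    have := mul_pos hθ hδ
    linarith
  have hXint : Integrable X μ := Integrable.of_bound hX B hB
  have hpt : ∀ᵐ ω ∂μ, Real.exp (θ * X ω) ≤ 1 + θ * X ω + θ * δ / 2 := by
    filter_upwards [hB] with ω hω
    have h1 : |θ * X ω| ≤ θ * b := by
      rw [abs_mul, abs_of_pos hθ]
      exact mul_le_mul_of_nonneg_left (hω.trans (le_max_left _ _)) hθ.le
    have h2 := (abs_le.1 (Real.abs_exp_sub_one_sub_id_le (h1.trans hθ1))).2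
    have h3 : (θ * X ω) ^ 2 ≤ (θ * b) ^ 2 := sq_le_sq' (abs_le.1 h1).1 (abs_le.1 h1).2
    have h4 := mul_le_mul_of_nonneg_left hθ2 hθ.le
    nlinarith
  have hint1 : Integrable (fun ω => 1 + θ * X ω) μ :=
    (integrable_const _).add (hXint.const_mul θ)
  have hint : Integrable (fun ω => 1 + θ * X ω + θ * δ / 2) μ := hint1.add (integrable_const _)
  calc ∫⁻ ω, ENNReal.ofReal (Real.exp (θ * X ω)) ∂μ
      ≤ ∫⁻ ω, ENNReal.ofReal (1 + θ * X ω + θ * δ / 2) ∂μ :=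
        lintegral_mono_ae (hpt.mono fun ω h => ENNReal.ofReal_le_ofReal h)
    _ = ENNReal.ofReal (∫ ω, (1 + θ * X ω + θ * δ / 2) ∂μ) := by
        rw [ofReal_integral_eq_lintegral_ofReal hint]
        exact hpt.mono fun ω h => (Real.exp_pos _).le.trans h
    _ ≤ ENNReal.ofReal (1 - θ * δ / 2) := by
        refine ENNReal.ofReal_le_ofReal ?_
        rw [integral_add hint1 (integrable_const _),
          integral_add (integrable_const _) (hXint.const_mul θ), integral_const_mul]
        simp only [integral_const, probReal_univ, one_smul]
        have := mul_le_mul_of_nonneg_left hm hθ.le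
        linarith

/-- A centred random variable with second moment at least `v` and fourth moment at most `K` is at
least `η` with probability at least `c`, where `η` and `c` depend only on `v` and `K`. -/
lemma exists_le_measureReal_ge {v K : ℝ} (hv : 0 < v) (hK : 0 < K) :
    ∃ η c : ℝ, 0 < η ∧ 0 < c ∧ ∀ {Ω : Type*} [MeasurableSpace Ω] (μ : Measure Ω)
      [IsProbabilityMeasure μ] (Z : Ω → ℝ), Measurable Z → Integrable Z μ →
      Integrable (fun ω => Z ω ^ 2) μ → Integrable (fun ω => Z ω ^ 4) μ →
      ∫ ω, Z ω ∂μ = 0 → v ≤ ∫ ω, Z ω ^ 2 ∂μ → ∫ ω, Z ω ^ 4 ∂μ ≤ K →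
      c ≤ μ.real {ω | η ≤ Z ω} := by
  -- The polynomial `α z + z² - γ z⁴ - v / 4` is at most `C` everywhere and nonpositive for `z < η`,
  -- but its expectation is at least `v / 4`.
  set γ := v / (2 * K)
  have hγ : 0 < γ := by positivity
  set α := 1 + 1 / γ
  have hα : 1 < α := lt_add_of_pos_right _ (by positivity)
  have hγα : 1 ≤ γ * α ^ 2 := by
    have : γ * α = γ + 1 := by simp only [α]; field_simp
    nlinarith
  set η := min 1 (v / (4 * (α + 1)))
  have hη : 0 < η := lt_min one_pos (by positivity)
  have hη1 : η * (4 * (α + 1)) ≤ v := (le_div_iff₀ (by positivity)).1 (min_le_right _ _)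
  set C := α ^ 2 + 1 / γ
  have hC : 0 < C := by positivity
  refine ⟨η, v / (4 * C), hη, by positivity, ?_⟩
  intro Ω _ μ _ Z hZ h1 h2 h4 e1 e2 e4
  have hpt : ∀ z : ℝ, α * z + z ^ 2 - γ * z ^ 4 - v / 4 ≤ if η ≤ z then C else 0 := by
    intro z
    split_ifs with hz
    · have h5 : 2 * z ^ 2 - γ * z ^ 4 ≤ 1 / γ := by
        rw [le_div_iff₀ hγ]
        nlinarith [sq_nonneg (γ * z ^ 2 - 1)]
      simp only [C]
      nlinarith [sq_nonneg (α - z)]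
    · rw [not_le] at hz
      have hz4 : 0 ≤ γ * z ^ 4 := by positivity
      rcases le_total 0 z with hz0 | hz0
      · have hz1 : z ≤ 1 := hz.le.trans (min_le_left _ _)
        have : α * z + z ^ 2 ≤ (α + 1) * η := by nlinarith
        linarith
      · rcases le_total (-α) z with hza | hza
        · nlinarith
        · have h6 : α ^ 2 ≤ z ^ 2 := by nlinarith
          have h7 : 1 ≤ γ * z ^ 2 := hγα.trans (mul_le_mul_of_nonneg_left h6 hγ.le)
          have h8 : z ^ 2 ≤ γ * z ^ 4 := by nlinarith [sq_nonneg z]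
          nlinarith
  have hms : MeasurableSet {ω | η ≤ Z ω} := measurableSet_le measurable_const hZ
  have hI : ∫ ω, (if η ≤ Z ω then C else 0) ∂μ = μ.real {ω | η ≤ Z ω} * C := by
    rw [← smul_eq_mul, ← integral_indicator_const C hms]
    rfl
  have hint1 : Integrable (fun ω => α * Z ω + Z ω ^ 2) μ := (h1.const_mul α).add h2
  have hint2 : Integrable (fun ω => α * Z ω + Z ω ^ 2 - γ * Z ω ^ 4) μ :=
    hint1.sub (h4.const_mul γ)
  have hle : ∫ ω, (α * Z ω + Z ω ^ 2 - γ * Z ω ^ 4 - v / 4) ∂μ ≤ μ.real {ω | η ≤ Z ω} * C := by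
    rw [← hI]
    refine integral_mono (hint2.sub (integrable_const _)) ?_ fun ω => hpt (Z ω)
    exact (integrable_const C).indicator hms
  rw [integral_sub hint2 (integrable_const _), integral_sub hint1 (h4.const_mul γ),
    integral_add (h1.const_mul α) h2, integral_const_mul, integral_const_mul, e1] at hle
  simp only [integral_const, probReal_univ, one_smul] at hle
  have hγK : γ * ∫ ω, Z ω ^ 4 ∂μ ≤ v / 2 := by
    calc γ * ∫ ω, Z ω ^ 4 ∂μ ≤ γ * K := mul_le_mul_of_nonneg_left e4 hγ.le
      _ = v / 2 := by simp only [γ]; field_simp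
  rw [div_le_iff₀ (by positivity)]
  nlinarith

end

/-! ### Divergence outside the rate set -/

section

variable {S : Type*} {E : EGS S}

lemma add_netInput_le_next (x : State S) (M : S → ℕ) (d : E.Draw) (s : S) :
    (x.1 s : ℝ) + E.netInput M d s ≤ ((next x M d).1 s : ℝ) := by
  have h : x.1 s + d.1 s ≤ (next x M d).1 s + E.successes M d.2 s := by
    simp only [next]
    omega
  have h' : (x.1 s : ℝ) + d.1 s ≤ ((next x M d).1 s : ℝ) + E.successes M d.2 s := by
    exact_mod_cast h
  rw [netInput]
  linarith

lemma next_le (x : State S) (M : S → ℕ) (d : E.Draw) (s : S) :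
    (next x M d).1 s ≤ x.1 s + d.1 s := Nat.sub_le _ _

lemma next_sq_le (x : State S) (M : S → ℕ) (d : E.Draw) (s : S) :
    ((next x M d).1 s : ℝ) ^ 2 ≤ ((x.1 s : ℝ) + E.netInput M d s) ^ 2 := by
  rcases le_total (x.1 s + d.1 s) (E.successes M d.2 s) with h | h
  · have h0 : (next x M d).1 s = 0 := Nat.sub_eq_zero_of_le h
    rw [h0]
    simpa using sq_nonneg _
  · have h0 : ((next x M d).1 s : ℝ) = (x.1 s : ℝ) + E.netInput M d s := by
      simp only [next, netInput]
      rw [Nat.cast_sub h]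
      push_cast
      ring
    rw [h0]

variable [Fintype S] {lam : S → ℝ}

/-- The sessions of the nonempty set `T` can never be allocated more than `c` resources in total,
where `1 ≤ c ≤ R`. The cases that matter are `T = {s}` with `c = x s` and the set of all sessions with `c = R`. -/
def IsBottleneck (E : EGS S) (T : Finset S) (c : ℕ) : Prop :=
  T.Nonempty ∧ 1 ≤ c ∧ c ≤ E.R ∧ ∀ M, E.IsAllocation M → ∑ s ∈ T, M s ≤ c

lemma isBottleneck_singleton (E : EGS S) (s : S) : E.IsBottleneck {s} (E.x s) :=
  ⟨Finset.singleton_nonempty s, E.one_le_x s, E.x_le_R s, fun M hM => by simpa using hM.1 s⟩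

lemma isBottleneck_univ (E : EGS S) [Nonempty S] : E.IsBottleneck Finset.univ E.R := by
  obtain ⟨s⟩ := ‹Nonempty S›
  exact ⟨⟨s, Finset.mem_univ s⟩, (E.one_le_x s).trans (E.x_le_R s), le_rfl, fun M hM => hM.2⟩

lemma exists_isBottleneck_lt (h0 : ∀ s, 0 ≤ lam s) (h : lam ∉ E.rateSet) :
    ∃ T c, E.IsBottleneck T c ∧ (E.pgen : ℝ) * c < ∑ s ∈ T, lam s := by
  by_cases hx : ∀ s, lam s ≤ E.x s * (E.pgen : ℝ)
  · have hR : E.R * (E.pgen : ℝ) < ∑ s, lam s := by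
      by_contra hR
      exact h ⟨h0, not_lt.1 hR, hx⟩
    have hS : Nonempty S := by
      by_contra hS
      rw [not_nonempty_iff] at hS
      rw [Finset.univ_eq_empty, Finset.sum_empty] at hR
      exact absurd hR (not_lt.2 (mul_nonneg (Nat.cast_nonneg _) E.pgen.2.1))
    exact ⟨_, _, E.isBottleneck_univ, by rwa [mul_comm]⟩
  · rw [not_forall] at hx
    obtain ⟨s, hs⟩ := hx
    refine ⟨_, _, E.isBottleneck_singleton s, ?_⟩
    rw [Finset.sum_singleton, mul_comm]
    exact not_le.1 hs

lemma IsAllocation.le_R {M : S → ℕ} (hM : E.IsAllocation M) (s : S) : M s ≤ E.R :=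
  (hM.1 s).trans (E.x_le_R s)

lemma ae_abs_sum_netInput_le (lam : S → ℝ) (M : S → ℕ) (T : Finset S) :
    ∀ᵐ d ∂(E.drawLaw lam), |∑ s ∈ T, E.netInput M d s| ≤ T.card * E.inputBound lam := by
  filter_upwards [E.ae_arrivals_le lam] with d hd
  refine (Finset.abs_sum_le_sum_abs _ _).trans ?_
  rw [← nsmul_eq_mul]
  exact Finset.sum_le_card_nsmul _ _ _ fun s _ => E.abs_netInput_le lam M (hd s)

lemma integral_sum_netInput (h0 : ∀ s, 0 ≤ lam s) {M : S → ℕ} (hM : ∀ s, M s ≤ E.R)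
    (T : Finset S) :
    ∫ d, ∑ s ∈ T, E.netInput M d s ∂(E.drawLaw lam) =
      ∑ s ∈ T, lam s - E.pgen * ((∑ s ∈ T, M s : ℕ) : ℝ) := by
  rw [integral_finsetSum _ fun s _ => E.integrable_netInput lam M s]
  simp_rw [fun s => E.integral_netInput (h0 s) (hM s)]
  rw [Finset.sum_sub_distrib, Nat.cast_sum, Finset.mul_sum]

/-- If a bottleneck is overloaded, `exp (-θ |q|)`, with `|q|` the number of demands queued at the
bottleneck, has exponentially decaying, hence summable, expectations. -/
lemma ae_tendsto_of_isBottleneck_lt (h0 : ∀ s, 0 ≤ lam s) {T : Finset S} {c : ℕ}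
    (hT : E.IsBottleneck T c) (hlt : (E.pgen : ℝ) * c < ∑ s ∈ T, lam s)
    (π : E.Policy) (q₀ : S → ℕ) :
    ∀ᵐ ω ∂(E.law lam), Tendsto (totalQueue π q₀ ω) atTop atTop := by
  obtain ⟨θ, hθ, ρ, hρ, hexp⟩ := exists_lintegral_exp_le (E.drawLaw lam)
    (T.card * E.inputBound lam) (sub_pos.2 hlt)
  set f : State S → ENNReal := fun x =>
    ENNReal.ofReal (Real.exp (-(θ * ((∑ s ∈ T, x.1 s : ℕ) : ℝ)))) with hf
  have hstep : ∀ (x : State S) (M : S → ℕ), E.IsAllocation M →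
      ∫⁻ d, f (next x M d) ∂(E.drawLaw lam) ≤ ρ * f x := by
    intro x M hM
    have hpt : ∀ d : E.Draw, f (next x M d) ≤
        f x * ENNReal.ofReal (Real.exp (θ * -∑ s ∈ T, E.netInput M d s)) := by
      intro d
      simp only [hf]
      rw [← ENNReal.ofReal_mul (Real.exp_pos _).le, ← Real.exp_add]
      refine ENNReal.ofReal_le_ofReal (Real.exp_le_exp.2 ?_)
      have h1 : ((∑ s ∈ T, x.1 s : ℕ) : ℝ) + ∑ s ∈ T, E.netInput M d s ≤
          ((∑ s ∈ T, (next x M d).1 s : ℕ) : ℝ) := by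
        push_cast
        rw [← Finset.sum_add_distrib]
        exact Finset.sum_le_sum fun s _ => add_netInput_le_next x M d s
      have h2 := mul_le_mul_of_nonneg_left h1 hθ.le
      linarith
    refine (lintegral_mono hpt).trans ?_
    rw [lintegral_const_mul _ (measurable_of_countable _), mul_comm]
    gcongr
    refine hexp _ (measurable_of_countable _).aestronglyMeasurable ?_ ?_
    · simpa only [abs_neg] using ae_abs_sum_netInput_le lam M T
    · rw [integral_neg, integral_sum_netInput h0 hM.le_R]
      have h1 : ((∑ s ∈ T, M s : ℕ) : ℝ) ≤ c := by exact_mod_cast hT.2.2.2 M hM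
      have h2 := mul_le_mul_of_nonneg_left h1 E.pgen.2.1
      linarith
  have hmeas : ∀ n, Measurable fun ω => f (run π q₀ ω n) := fun n =>
    (measurable_of_countable f).comp (measurable_run π q₀ n)
  have hgeom : ∀ n, ∫⁻ ω, f (run π q₀ ω n) ∂(E.law lam) ≤ ρ ^ n := by
    intro n
    induction n with
    | zero =>
      calc _ ≤ ∫⁻ _, 1 ∂(E.law lam) := lintegral_mono fun ω => by
            simp only [hf]
            rw [ENNReal.ofReal_le_one, Real.exp_le_one_iff]
            have : 0 ≤ θ * ((∑ s ∈ T, (run π q₀ ω 0).1 s : ℕ) : ℝ) := by positivity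
            linarith
        _ = ρ ^ 0 := by simp
    | succ n ih =>
      calc _ ≤ ∫⁻ ω, ρ * f (run π q₀ ω n) ∂(E.law lam) :=
            lintegral_run_succ_le lam π q₀ (g := fun x => ρ * f x)
              (Eventually.of_forall fun ω u => hstep _ _ (π.isAllocation _ _ _))
        _ = ρ * ∫⁻ ω, f (run π q₀ ω n) ∂(E.law lam) :=
            lintegral_const_mul _ (hmeas n)
        _ ≤ ρ * ρ ^ n := by gcongr
        _ = ρ ^ (n + 1) := (pow_succ' _ _).symm
  have hsum : ∫⁻ ω, ∑' n, f (run π q₀ ω n) ∂(E.law lam) ≠ ⊤ := by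
    rw [lintegral_tsum fun n => (hmeas n).aemeasurable]
    refine ne_top_of_le_ne_top ?_ (ENNReal.tsum_le_tsum hgeom)
    rw [ENNReal.tsum_geometric]
    exact ENNReal.inv_ne_top.2 (tsub_pos_of_lt hρ).ne'
  have hfin := ae_lt_top (Measurable.tsum hmeas) hsum
  filter_upwards [hfin] with ω hω
  have hlim := ENNReal.tendsto_atTop_zero_of_tsum_ne_top hω.ne
  refine tendsto_atTop.2 fun Q => ?_
  have hQ : 0 < ENNReal.ofReal (Real.exp (-(θ * (Q : ℝ)))) :=
    ENNReal.ofReal_pos.2 (Real.exp_pos _)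
  filter_upwards [hlim.eventually (gt_mem_nhds hQ)] with n hn
  simp only [hf] at hn
  rw [ENNReal.ofReal_lt_ofReal_iff (Real.exp_pos _), Real.exp_lt_exp, neg_lt_neg_iff,
    mul_lt_mul_iff_right₀ hθ, Nat.cast_lt] at hn
  exact hn.le.trans (Finset.sum_le_sum_of_subset (Finset.subset_univ T))

end

/-! ### Instability on the boundary of the rate set -/

section

variable {S : Type*}

open Classical in
/-- The schedule `M` with additional resources for session `s₀`, so that the sessions of `T`
(among them `s₀`) get `c` resources in total. It need not be an allocation. -/
def fill (T : Finset S) (c : ℕ) (s₀ : S) (M : S → ℕ) : S → ℕ :=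
  Function.update M s₀ (M s₀ + (c - ∑ s ∈ T, M s))

lemma le_fill (T : Finset S) (c : ℕ) (s₀ : S) (M : S → ℕ) (s : S) : M s ≤ fill T c s₀ M s := by
  unfold fill
  by_cases hs : s = s₀
  · subst hs
    simp
  · simp [hs]

lemma sum_fill {T : Finset S} {c : ℕ} {s₀ : S} (hs₀ : s₀ ∈ T) {M : S → ℕ}
    (hM : ∑ s ∈ T, M s ≤ c) : ∑ s ∈ T, fill T c s₀ M s = c := by
  classical
  unfold fill
  have h := Finset.add_sum_erase T M hs₀
  rw [Finset.sum_update_of_mem hs₀, Finset.sdiff_singleton_eq_erase]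
  omega

variable {E : EGS S}

lemma netInput_fill_le (T : Finset S) (c : ℕ) (s₀ : S) (M : S → ℕ) (d : E.Draw) (s : S) :
    E.netInput (fill T c s₀ M) d s ≤ E.netInput M d s := by
  have h : E.successes M d.2 s ≤ E.successes (fill T c s₀ M) d.2 s :=
    E.successes_mono (le_fill T c s₀ M s) d.2
  have h' : (E.successes M d.2 s : ℝ) ≤ E.successes (fill T c s₀ M) d.2 s := Nat.cast_le.2 h
  rw [netInput, netInput]
  linarith

variable [Fintype S] {lam : S → ℝ}

lemma integral_eq_integral_update {G : (ℕ → E.Noise) → ℝ} (hG : Integrable G (E.law lam)) (n : ℕ) :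
    Integrable (fun ω => ∫ z, G (Function.update ω n z) ∂(E.slotLaw lam)) (E.law lam) ∧
      ∫ ω, G ω ∂(E.law lam) =
        ∫ ω, ∫ z, G (Function.update ω n z) ∂(E.slotLaw lam) ∂(E.law lam) := by
  have hmp := measurePreserving_update (E := E) lam n
  have h2 : Integrable (fun p : (ℕ → E.Noise) × E.Noise => G (Function.update p.1 n p.2))
      ((E.law lam).prod (E.slotLaw lam)) := hmp.integrable_comp_of_integrable hG
  refine ⟨h2.integral_prod_left, ?_⟩
  have h1 : ∫ ω, G ω ∂(E.law lam) = ∫ p : (ℕ → E.Noise) × E.Noise, G (Function.update p.1 n p.2)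
      ∂((E.law lam).prod (E.slotLaw lam)) := by
    conv_lhs => rw [← hmp.map_eq]
    refine integral_map hmp.measurable.aemeasurable ?_
    rw [hmp.map_eq]
    exact hG.aestronglyMeasurable
  rw [h1, integral_prod _ h2]

/-- The partial sums of the increments `Y`, which may depend on the current state and on the
randomness of the slot. -/
def walk (π : E.Policy) (q₀ : S → ℕ) (Y : State S → E.Noise → ℝ) (n : ℕ) (ω : ℕ → E.Noise) : ℝ :=
  ∑ k ∈ Finset.range n, Y (run π q₀ ω k) (ω k)

/-- `Y` is a centred increment, almost surely bounded by `B`, with conditional second moment at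
least `v`. -/
structure IsIncrement (lam : S → ℝ) (Y : State S → E.Noise → ℝ) (B v : ℝ) : Prop where
  measurable : Measurable fun p : State S × E.Noise => Y p.1 p.2
  abs_le_of_arrivals_le : ∀ x z, (∀ s, z.2.1 s ≤ ⌊lam s⌋₊ + 1) → |Y x z| ≤ B
  integral_eq_zero : ∀ x, ∫ z, Y x z ∂(E.slotLaw lam) = 0
  le_integral_sq : ∀ x, v ≤ ∫ z, Y x z ^ 2 ∂(E.slotLaw lam)

section Walk

variable (π : E.Policy) (q₀ : S → ℕ) {Y : State S → E.Noise → ℝ} {B v : ℝ}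

lemma walk_update_succ (n : ℕ) (ω : ℕ → E.Noise) (z : E.Noise) :
    walk π q₀ Y (n + 1) (Function.update ω n z) = walk π q₀ Y n ω + Y (run π q₀ ω n) z := by
  rw [walk, Finset.sum_range_succ, run_update π q₀ ω le_rfl, Function.update_self, walk]
  congr 1
  refine Finset.sum_congr rfl fun k hk => ?_
  have hk' := Finset.mem_range.1 hk
  rw [run_update π q₀ ω hk'.le, Function.update_of_ne hk'.ne]

lemma IsIncrement.ae_abs_le (hY : IsIncrement lam Y B v) (x : State S) :
    ∀ᵐ z ∂(E.slotLaw lam), |Y x z| ≤ B := by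
  have h : MeasurePreserving (fun z : E.Noise => z.2) (E.slotLaw lam) (E.drawLaw lam) :=
    measurePreserving_snd
  exact (h.quasiMeasurePreserving.ae (E.ae_arrivals_le lam)).mono fun z hz => hY.abs_le_of_arrivals_le x z hz

lemma IsIncrement.integrable_pow (hY : IsIncrement lam Y B v) (x : State S) (k : ℕ) :
    Integrable (fun z => Y x z ^ k) (E.slotLaw lam) := by
  refine Integrable.of_bound (C := B ^ k)
    ((hY.measurable.comp measurable_prodMk_left).pow_const k).aestronglyMeasurable ?_
  filter_upwards [hY.ae_abs_le x] with z hz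
  rw [norm_pow]
  exact pow_le_pow_left₀ (abs_nonneg _) hz k

lemma IsIncrement.integrable (hY : IsIncrement lam Y B v) (x : State S) :
    Integrable (fun z => Y x z) (E.slotLaw lam) := by
  simpa using hY.integrable_pow x 1

lemma IsIncrement.measurable_walk (hY : IsIncrement lam Y B v) (n : ℕ) :
    Measurable (walk π q₀ Y n) :=
  Finset.measurable_fun_sum _ fun k _ =>
    hY.measurable.comp ((measurable_run π q₀ k).prodMk (measurable_pi_apply k))

lemma IsIncrement.integrable_walk_pow (hY : IsIncrement lam Y B v) (n k : ℕ) :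
    Integrable (fun ω => walk π q₀ Y n ω ^ k) (E.law lam) := by
  refine Integrable.of_bound (C := (n * B) ^ k)
    ((hY.measurable_walk π q₀ n).pow_const k).aestronglyMeasurable ?_
  filter_upwards [ae_forall_arrivals_le (E := E) lam] with ω hω
  rw [norm_pow]
  refine pow_le_pow_left₀ (abs_nonneg _) ((Finset.abs_sum_le_sum_abs _ _).trans ?_) k
  calc _ ≤ (Finset.range n).card • B :=
        Finset.sum_le_card_nsmul _ _ _ fun j _ => hY.abs_le_of_arrivals_le _ _ (hω j)
    _ = n * B := by simp

lemma IsIncrement.integral_walk (hY : IsIncrement lam Y B v) (n : ℕ) :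
    ∫ ω, walk π q₀ Y n ω ∂(E.law lam) = 0 := by
  induction n with
  | zero => simp [walk]
  | succ n ih =>
    have hi : Integrable (walk π q₀ Y (n + 1)) (E.law lam) := by
      simpa using hY.integrable_walk_pow π q₀ (n + 1) 1
    rw [(integral_eq_integral_update hi n).2, ← ih]
    refine integral_congr_ae (Eventually.of_forall fun ω => ?_)
    simp only [walk_update_succ]
    rw [integral_add (integrable_const _) (hY.integrable _), hY.integral_eq_zero]
    simp

lemma IsIncrement.integral_walk_sq (hY : IsIncrement lam Y B v) (n : ℕ) :
    n * v ≤ ∫ ω, walk π q₀ Y n ω ^ 2 ∂(E.law lam) ∧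
      ∫ ω, walk π q₀ Y n ω ^ 2 ∂(E.law lam) ≤ n * B ^ 2 := by
  induction n with
  | zero => simp [walk]
  | succ n ih =>
    have hinner : ∀ ω, ∫ z, walk π q₀ Y (n + 1) (Function.update ω n z) ^ 2 ∂(E.slotLaw lam) =
        walk π q₀ Y n ω ^ 2 + ∫ z, Y (run π q₀ ω n) z ^ 2 ∂(E.slotLaw lam) := by
      intro ω
      have hexp : ∀ z, walk π q₀ Y (n + 1) (Function.update ω n z) ^ 2 =
          (walk π q₀ Y n ω ^ 2 + 2 * walk π q₀ Y n ω * Y (run π q₀ ω n) z) +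
            Y (run π q₀ ω n) z ^ 2 := by
        intro z
        rw [walk_update_succ]
        ring
      simp_rw [hexp]
      have hlin : Integrable (fun z => walk π q₀ Y n ω ^ 2 +
          2 * walk π q₀ Y n ω * Y (run π q₀ ω n) z) (E.slotLaw lam) :=
        (integrable_const _).add ((hY.integrable _).const_mul _)
      rw [integral_add hlin (hY.integrable_pow _ 2), integral_add (integrable_const _) ((hY.integrable _).const_mul _),
        integral_const_mul, hY.integral_eq_zero]
      simp
    have hup : ∀ x, ∫ z, Y x z ^ 2 ∂(E.slotLaw lam) ≤ B ^ 2 := by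
      intro x
      calc _ ≤ ∫ _, B ^ 2 ∂(E.slotLaw lam) := by
            refine integral_mono_ae (hY.integrable_pow x 2) (integrable_const _) ?_
            filter_upwards [hY.ae_abs_le x] with z hz
            exact sq_le_sq' (abs_le.1 hz).1 (abs_le.1 hz).2
        _ = B ^ 2 := by simp
    obtain ⟨h1, h2⟩ := integral_eq_integral_update (hY.integrable_walk_pow π q₀ (n + 1) 2) n
    have h3 := hY.integrable_walk_pow π q₀ n 2
    have hadd : ∀ C : ℝ, ∫ ω, (walk π q₀ Y n ω ^ 2 + C) ∂(E.law lam) =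
        ∫ ω, walk π q₀ Y n ω ^ 2 ∂(E.law lam) + C := by
      intro C
      rw [integral_add h3 (integrable_const _)]
      simp
    rw [h2]
    push_cast
    constructor
    · calc _ ≤ ∫ ω, (walk π q₀ Y n ω ^ 2 + v) ∂(E.law lam) := by
            rw [hadd]
            linarith [ih.1]
        _ ≤ _ := by
            refine integral_mono (h3.add (integrable_const _)) h1 fun ω => ?_
            simp only
            rw [hinner]
            linarith [hY.le_integral_sq (run π q₀ ω n)]
    · calc _ ≤ ∫ ω, (walk π q₀ Y n ω ^ 2 + B ^ 2) ∂(E.law lam) := by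
            refine integral_mono h1 (h3.add (integrable_const _)) fun ω => ?_
            simp only
            rw [hinner]
            linarith [hup (run π q₀ ω n)]
        _ ≤ _ := by
            rw [hadd]
            linarith [ih.2]

lemma IsIncrement.integral_walk_pow_four_le (hY : IsIncrement lam Y B v) (n : ℕ) :
    ∫ ω, walk π q₀ Y n ω ^ 4 ∂(E.law lam) ≤ 8 * B ^ 4 * n ^ 2 := by
  induction n with
  | zero => simp [walk]
  | succ n ih =>
    have hinner : ∀ ω, ∫ z, walk π q₀ Y (n + 1) (Function.update ω n z) ^ 4 ∂(E.slotLaw lam) ≤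
        walk π q₀ Y n ω ^ 4 + 8 * B ^ 2 * walk π q₀ Y n ω ^ 2 + 3 * B ^ 4 := by
      intro ω
      set L := walk π q₀ Y n ω
      have hi : Integrable (fun z => (L ^ 4 + 8 * B ^ 2 * L ^ 2 + 3 * B ^ 4) +
          4 * L ^ 3 * Y (run π q₀ ω n) z) (E.slotLaw lam) :=
        (integrable_const _).add ((hY.integrable _).const_mul _)
      have hpow : Integrable (fun z => (L + Y (run π q₀ ω n) z) ^ 4) (E.slotLaw lam) := by
        refine Integrable.of_bound (C := (|L| + B) ^ 4) ((measurable_const.add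
          (hY.measurable.comp measurable_prodMk_left)).pow_const 4).aestronglyMeasurable ?_
        filter_upwards [hY.ae_abs_le (run π q₀ ω n)] with z hz
        rw [norm_pow]
        exact pow_le_pow_left₀ (norm_nonneg _) ((abs_add_le _ _).trans (by gcongr)) 4
      calc _ = ∫ z, (L + Y (run π q₀ ω n) z) ^ 4 ∂(E.slotLaw lam) := by
            simp_rw [walk_update_succ]
            rfl
        _ ≤ ∫ z, ((L ^ 4 + 8 * B ^ 2 * L ^ 2 + 3 * B ^ 4) +
              4 * L ^ 3 * Y (run π q₀ ω n) z) ∂(E.slotLaw lam) := by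
            refine integral_mono_ae hpow hi ?_
            filter_upwards [hY.ae_abs_le (run π q₀ ω n)] with z hz
            set y := Y (run π q₀ ω n) z
            have h1 : y ^ 2 ≤ B ^ 2 := sq_le_sq' (abs_le.1 hz).1 (abs_le.1 hz).2
            have h2 : y ^ 4 ≤ B ^ 4 := by
              have := pow_le_pow_left₀ (sq_nonneg y) h1 2
              nlinarith
            have h3 : L ^ 2 * y ^ 2 ≤ L ^ 2 * B ^ 2 := mul_le_mul_of_nonneg_left h1 (sq_nonneg L)
            -- `4 L y³ ≤ 2 (L y)² + 2 y⁴`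
            have h4 : 0 ≤ (y * (L - y)) ^ 2 := sq_nonneg _
            nlinarith
        _ = _ := by
            rw [integral_add (integrable_const _) ((hY.integrable _).const_mul _),
              integral_const_mul, hY.integral_eq_zero]
            simp
    obtain ⟨h1, h2⟩ := integral_eq_integral_update (hY.integrable_walk_pow π q₀ (n + 1) 4) n
    have h3 := hY.integrable_walk_pow π q₀ n 4
    have h4 := (hY.integrable_walk_pow π q₀ n 2).const_mul (8 * B ^ 2)
    have h34 : Integrable (fun ω => walk π q₀ Y n ω ^ 4 + 8 * B ^ 2 * walk π q₀ Y n ω ^ 2)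
      (E.law lam) := h3.add h4
    rw [h2]
    calc _ ≤ ∫ ω, (walk π q₀ Y n ω ^ 4 + 8 * B ^ 2 * walk π q₀ Y n ω ^ 2 + 3 * B ^ 4)
            ∂(E.law lam) := integral_mono h1 (h34.add (integrable_const _)) hinner
      _ = ∫ ω, walk π q₀ Y n ω ^ 4 ∂(E.law lam) +
            8 * B ^ 2 * ∫ ω, walk π q₀ Y n ω ^ 2 ∂(E.law lam) + 3 * B ^ 4 := by
          rw [integral_add h34 (integrable_const _), integral_add h3 h4, integral_const_mul]
          simp
      _ ≤ 8 * B ^ 4 * n ^ 2 + 8 * B ^ 2 * (n * B ^ 2) + 3 * B ^ 4 := by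
          gcongr
          exact (hY.integral_walk_sq π q₀ n).2
      _ ≤ _ := by
          push_cast
          have h5 : 0 ≤ B ^ 4 := by positivity
          have h6 : 0 ≤ B ^ 4 * n := by positivity
          nlinarith

/-- A nondegenerate martingale with bounded increments exceeds every level with probability bounded
away from zero. -/
lemma IsIncrement.exists_le_law_walk (hY : IsIncrement lam Y B v) (hB : 0 < B) (hv : 0 < v) :
    ∃ c : ENNReal, 0 < c ∧
      ∀ Q : ℕ, ∀ᶠ n in atTop, c ≤ E.law lam {ω | (Q : ℝ) ≤ walk π q₀ Y n ω} := by
  obtain ⟨η, c, hη, hc, h⟩ := exists_le_measureReal_ge hv (show 0 < 8 * B ^ 4 by positivity)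
  refine ⟨ENNReal.ofReal c, ENNReal.ofReal_pos.2 hc, fun Q => ?_⟩
  have hlarge : ∀ᶠ n : ℕ in atTop, (Q : ℝ) ≤ η * √(n : ℝ) :=
    ((Real.tendsto_sqrt_atTop.comp tendsto_natCast_atTop_atTop).const_mul_atTop
      hη).eventually_ge_atTop _
  filter_upwards [hlarge, eventually_gt_atTop 0] with n hn hn0
  have hn0' : (0 : ℝ) < n := by exact_mod_cast hn0
  have hr : 0 < √(n : ℝ) := Real.sqrt_pos.2 hn0'
  have hr2 : √(n : ℝ) ^ 2 = n := Real.sq_sqrt hn0'.le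
  have hr4 : √(n : ℝ) ^ 4 = (n : ℝ) ^ 2 := by
    rw [show 4 = 2 * 2 from rfl, pow_mul, hr2]
  have h1 := h (E.law lam) (fun ω => walk π q₀ Y n ω / √(n : ℝ))
    ((hY.measurable_walk π q₀ n).div_const _)
    (by simpa using (hY.integrable_walk_pow π q₀ n 1).div_const _)
    (by simpa only [div_pow] using (hY.integrable_walk_pow π q₀ n 2).div_const _)
    (by simpa only [div_pow] using (hY.integrable_walk_pow π q₀ n 4).div_const _)
    (by rw [integral_div, hY.integral_walk, zero_div])
    (by
      simp only [div_pow]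
      rw [integral_div, le_div_iff₀ (by positivity), hr2, mul_comm]
      exact (hY.integral_walk_sq π q₀ n).1)
    (by
      simp only [div_pow]
      rw [integral_div, div_le_iff₀ (by positivity), hr4]
      exact hY.integral_walk_pow_four_le π q₀ n)
  calc ENNReal.ofReal c ≤ E.law lam {ω | η ≤ walk π q₀ Y n ω / √(n : ℝ)} :=
        ENNReal.ofReal_le_of_le_toReal h1
    _ ≤ _ := measure_mono fun ω hω => by
        have hω' : η ≤ walk π q₀ Y n ω / √(n : ℝ) := hω
        rw [le_div_iff₀ hr] at hω'
        exact hn.trans hω'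

end Walk

lemma fill_le_R {T : Finset S} {c : ℕ} (hT : E.IsBottleneck T c) {s₀ : S} (hs₀ : s₀ ∈ T)
    {M : S → ℕ} (hM : E.IsAllocation M) (s : S) : fill T c s₀ M s ≤ E.R := by
  by_cases hs : s = s₀
  · subst hs
    exact ((Finset.single_le_sum (fun _ _ => Nat.zero_le _) hs₀).trans
      (sum_fill hs₀ (hT.2.2.2 M hM)).le).trans hT.2.2.1
  · simpa [fill, hs] using hM.le_R s

/-- At a bottleneck with load exactly one, the queue dominates a nondegenerate martingale, namely
the sum of the net inputs when all `c` resources of the bottleneck are used in every slot. -/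
lemma not_stableFrom_of_isBottleneck_eq (hp0 : 0 < E.pgen) (hp1 : E.pgen < 1)
    (h0 : ∀ s, 0 ≤ lam s) {T : Finset S} {c : ℕ} (hT : E.IsBottleneck T c)
    (heq : ∑ s ∈ T, lam s = E.pgen * c) (π : E.Policy) (q₀ : S → ℕ) :
    ¬ StableFrom π lam q₀ := by
  obtain ⟨s₀, hs₀⟩ := hT.1
  set Y : State S → E.Noise → ℝ := fun x z =>
    ∑ s ∈ T, E.netInput (fill T c s₀ (π.schedAt x z.1)) z.2 s with hYdef
  obtain ⟨v, hv, hsq'⟩ : ∃ v : ℝ, 0 < v ∧ ∀ M : S → ℕ, (∀ s, M s ≤ E.R) → 1 ≤ ∑ s ∈ T, M s →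
      v ≤ ∫ d, (∑ s ∈ T, E.netInput M d s) ^ 2 ∂(E.drawLaw lam) := by
    have h1 : (0 : ℝ) < E.pgen := hp0
    have h2 : (0 : ℝ) < 1 - E.pgen := sub_pos.2 hp1
    exact ⟨_, lt_min (pow_pos h1 _) (pow_pos h2 _),
      fun M => E.le_integral_sq_sum_netInput lam T⟩
  set B := T.card * E.inputBound lam
  have hB : 0 < B := mul_pos (by exact_mod_cast hT.1.card_pos)
    (zero_lt_one.trans_le (E.one_le_inputBound lam))
  have hmeas : Measurable fun p : State S × E.Noise => Y p.1 p.2 :=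
    measurable_comp_schedAt π fun _ M d => ∑ s ∈ T, E.netInput (fill T c s₀ M) d s
  have hbound : ∀ x z, (∀ s, z.2.1 s ≤ ⌊lam s⌋₊ + 1) → |Y x z| ≤ B := by
    intro x z hz
    refine (Finset.abs_sum_le_sum_abs _ _).trans ?_
    simp only [B]
    rw [← nsmul_eq_mul]
    exact Finset.sum_le_card_nsmul _ _ _ fun s _ => E.abs_netInput_le lam _ (hz s)
  have hint : ∀ x k, Integrable (fun z => Y x z ^ k) (E.slotLaw lam) := by
    intro x k
    refine Integrable.of_bound (C := B ^ k)
      ((hmeas.comp measurable_prodMk_left).pow_const k).aestronglyMeasurable ?_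
    have h : MeasurePreserving (fun z : E.Noise => z.2) (E.slotLaw lam) (E.drawLaw lam) :=
      measurePreserving_snd
    filter_upwards [h.quasiMeasurePreserving.ae (E.ae_arrivals_le lam)] with z hz
    rw [norm_pow]
    exact pow_le_pow_left₀ (abs_nonneg _) (hbound x z hz) k
  have halloc : ∀ x u, E.IsAllocation (π.schedAt x u) := fun x u => π.isAllocation _ _ _
  have hsq : ∀ x u, v ≤ ∫ d, Y x (u, d) ^ 2 ∂(E.drawLaw lam) := by
    intro x u
    have h1 : 1 ≤ ∑ s ∈ T, fill T c s₀ (π.schedAt x u) s := by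
      rw [sum_fill hs₀ (hT.2.2.2 _ (halloc x u))]
      exact hT.2.1
    have h2 : ∀ s, fill T c s₀ (π.schedAt x u) s ≤ E.R := fill_le_R hT hs₀ (halloc x u)
    have h3 := hsq' (fill T c s₀ (π.schedAt x u)) h2 h1
    simp only [hYdef]
    exact h3
  have hY : IsIncrement lam Y B v := by
    refine ⟨hmeas, hbound, fun x => ?_, fun x => ?_⟩
    · have h1 := hint x 1
      simp only [pow_one] at h1
      rw [slotLaw_eq] at h1 ⊢
      rw [integral_prod _ h1]
      have : ∀ u, ∫ d, Y x (u, d) ∂(E.drawLaw lam) = 0 := by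
        intro u
        simp only [hYdef]
        rw [integral_sum_netInput h0 (fill_le_R hT hs₀ (halloc x u)),
          sum_fill hs₀ (hT.2.2.2 _ (halloc x u)), heq, sub_self]
      simp [this]
    · have h1 := hint x 2
      rw [slotLaw_eq] at h1 ⊢
      rw [integral_prod _ h1]
      calc v = ∫ _ : unitInterval, v := by simp
        _ ≤ _ := by
          exact integral_mono (integrable_const _) h1.integral_prod_left (hsq x)
  have hdom : ∀ n ω, walk π q₀ Y n ω ≤ ((∑ s ∈ T, (run π q₀ ω n).1 s : ℕ) : ℝ) := by
    intro n ω
    induction n with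
    | zero =>
      simp only [walk, Finset.range_zero, Finset.sum_empty]
      positivity
    | succ n ih =>
      rw [walk, Finset.sum_range_succ]
      refine (add_le_add_left ih _).trans ?_
      rw [run_succ, step]
      push_cast
      simp only [hYdef]
      rw [← Finset.sum_add_distrib]
      refine Finset.sum_le_sum fun s _ => ?_
      refine le_trans ?_ (add_netInput_le_next (run π q₀ ω n)
        (π.schedAt (run π q₀ ω n) (ω n).1) (ω n).2 s)
      have := netInput_fill_le T c s₀ (π.schedAt (run π q₀ ω n) (ω n).1) (ω n).2 s
      linarith
  obtain ⟨ε, hε, h⟩ := hY.exists_le_law_walk π q₀ hB hv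
  refine not_stableFrom_of_eventually_le hε fun Q => ?_
  filter_upwards [h Q] with n hn
  refine hn.trans (measure_mono fun ω hω => ?_)
  have h1 : (Q : ℝ) ≤ ((∑ s ∈ T, (run π q₀ ω n).1 s : ℕ) : ℝ) := le_trans hω (hdom n ω)
  have h2 : Q ≤ ∑ s ∈ T, (run π q₀ ω n).1 s := by exact_mod_cast h1
  exact h2.trans (Finset.sum_le_sum_of_subset (Finset.subset_univ T))

end

/-! ### Maximum weight schedules solve the linear relaxation -/

section

variable {S : Type*} [Fintype S]

/-- An integral allocation of maximum weight has maximum weight among all real ones: by an exchange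
argument there is a price `θ` such that sessions of larger weight are at their cap and
sessions of smaller weight get nothing. -/
lemma sum_mul_le_of_forall_nat {c M w : S → ℕ} {r : ℕ} (hMc : ∀ s, M s ≤ c s)
    (hMr : ∑ s, M s ≤ r)
    (hmax : ∀ M' : S → ℕ, (∀ s, M' s ≤ c s) → ∑ s, M' s ≤ r → ∑ s, w s * M' s ≤ ∑ s, w s * M s)
    {y : S → ℝ} (hy0 : ∀ s, 0 ≤ y s) (hyc : ∀ s, y s ≤ c s) (hyr : ∑ s, y s ≤ r) :
    ∑ s, (w s : ℝ) * y s ≤ ∑ s, (w s : ℝ) * M s := by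
  classical
  set θ : ℕ := (Finset.univ.filter fun t => M t < c t).sup w with hθ
  have hle : ∀ t, M t < c t → w t ≤ θ := fun t ht =>
    Finset.le_sup (f := w) (Finset.mem_filter.2 ⟨Finset.mem_univ t, ht⟩)
  have hge : ∀ s, 0 < M s → θ ≤ w s := by
    intro s hs
    refine Finset.sup_le fun t ht => ?_
    have htc : M t < c t := (Finset.mem_filter.1 ht).2
    by_contra hlt
    rw [not_le] at hlt
    have hst : s ≠ t := by
      rintro rfl
      exact lt_irrefl _ hlt
    -- move one resource from `s` to `t`
    have hsum : ∀ v : S → ℕ,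
        ∑ k, v k * (M k + (if k = t then 1 else 0)) =
          ∑ k, v k * (M k - (if k = s then 1 else 0) + (if k = t then 1 else 0)) + v s := by
      intro v
      have : ∀ k, v k * (M k + (if k = t then 1 else 0)) =
          v k * (M k - (if k = s then 1 else 0) + (if k = t then 1 else 0)) +
            (if k = s then v k else 0) := by
        intro k
        by_cases hk : k = s
        · subst hk
          obtain ⟨m, hm⟩ := Nat.exists_eq_succ_of_ne_zero hs.ne'
          simp only [hm, hst, if_true, if_false]
          simp only [Nat.succ_eq_add_one, Nat.add_sub_cancel]
          ring
        · simp [hk]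
      simp_rw [this]
      rw [Finset.sum_add_distrib]
      simp
    have hadd : ∀ v : S → ℕ,
        ∑ k, v k * (M k + (if k = t then 1 else 0)) = ∑ k, v k * M k + v t := by
      intro v
      simp [mul_add, Finset.sum_add_distrib]
    have h1 := hmax (fun k => M k - (if k = s then 1 else 0) + (if k = t then 1 else 0))
      (fun k => by
        have := hMc k
        by_cases hk : k = t
        · subst hk
          simp only [if_true]
          omega
        · simp only [hk, if_false]
          omega)
      (by
        have e1 := hsum fun _ => 1
        have e2 := hadd fun _ => 1
        simp only [one_mul] at e1 e2
        omega)
    have e1 := hsum w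
    have e2 := hadd w
    omega
  have hslack : (θ : ℝ) * (∑ s, y s - ∑ s, (M s : ℝ)) ≤ 0 := by
    rcases hMr.lt_or_eq with hlt | heq
    · have hzero : θ = 0 := by
        refine Nat.le_zero.1 (Finset.sup_le fun t ht => ?_)
        have htc : M t < c t := (Finset.mem_filter.1 ht).2
        have h1 := hmax (fun k => M k + (if k = t then 1 else 0))
          (fun k => by
            have := hMc k
            by_cases hk : k = t
            · subst hk
              simpa using htc
            · simpa [hk] using this)
          (by
            rw [Finset.sum_add_distrib]
            simpa using hlt)
        have h2 : ∑ k, w k * (M k + (if k = t then 1 else 0)) = ∑ k, w k * M k + w t := by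
          simp [mul_add, Finset.sum_add_distrib]
        omega
      simp [hzero]
    · have : ∑ s, (M s : ℝ) = r := by exact_mod_cast heq
      rw [this]
      exact mul_nonpos_of_nonneg_of_nonpos (Nat.cast_nonneg _) (sub_nonpos.2 hyr)
  have hpt : ∀ s, (w s : ℝ) * y s - w s * M s ≤ θ * (y s - M s) := by
    intro s
    rcases lt_or_ge (M s) (c s) with h | h
    · rcases Nat.eq_zero_or_pos (M s) with h0 | h0
      · have h1 : (w s : ℝ) ≤ θ := by exact_mod_cast hle s h
        rw [h0]
        push_cast
        nlinarith [hy0 s]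
      · rw [le_antisymm (hle s h) (hge s h0)]
        linarith
    · have hMs : M s = c s := le_antisymm (hMc s) h
      rcases Nat.eq_zero_or_pos (M s) with h0 | h0
      · have : y s = 0 := le_antisymm (by simpa [← hMs, h0] using hyc s) (hy0 s)
        simp [h0, this]
      · have h1 : (θ : ℝ) ≤ w s := by exact_mod_cast hge s h0
        have h2 : y s ≤ M s := by
          rw [hMs]
          exact hyc s
        nlinarith
  have := Finset.sum_le_sum fun s (_ : s ∈ Finset.univ) => hpt s
  rw [← Finset.mul_sum, Finset.sum_sub_distrib, Finset.sum_sub_distrib] at this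
  linarith

end

section

variable {S : Type*} [Fintype S] {E : EGS S} {lam : S → ℝ}

lemma IsDemandBased.isAllocation {q M : S → ℕ} (h : E.IsDemandBased q M) : E.IsAllocation M :=
  ⟨h.1, h.2.1.trans (min_le_right _ _)⟩

/-- The restriction to demand based schedules costs only a constant, as a session whose queue is
shorter than the number of resources it deserves has a bounded weight. -/
lemma IsMaxWeightSchedule.sum_mul_le {q M : S → ℕ} (h : E.IsMaxWeightSchedule q M) {y : S → ℝ}
    (hy0 : ∀ s, 0 ≤ y s) (hyx : ∀ s, y s ≤ E.x s) (hyR : ∑ s, y s ≤ E.R) :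
    ∑ s, (q s : ℝ) * y s - ∑ s, y s ^ 2 ≤ ∑ s, (q s : ℝ) * M s := by
  have h1 := sum_mul_le_of_forall_nat (c := fun s => min (q s) (E.x s)) (w := q)
    (r := min (∑ s, q s) E.R) h.1.2.2 h.1.2.1
    (fun M' hc hr => h.2 M' ⟨fun s => (hc s).trans (min_le_right _ _), hr, hc⟩)
    (y := fun s => min (q s : ℝ) (y s)) (fun s => le_min (Nat.cast_nonneg _) (hy0 s))
    (fun s => by
      push_cast
      exact min_le_min_left _ (hyx s))
    (by
      push_cast
      exact le_min (Finset.sum_le_sum fun s _ => min_le_left _ _)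
        ((Finset.sum_le_sum fun s _ => min_le_right _ _).trans hyR))
  refine le_trans ?_ h1
  rw [← Finset.sum_sub_distrib]
  refine Finset.sum_le_sum fun s _ => ?_
  have hq : (0 : ℝ) ≤ q s := Nat.cast_nonneg _
  rcases le_total (q s : ℝ) (y s) with hs | hs
  · rw [min_eq_left hs]
    nlinarith
  · rw [min_eq_right hs]
    nlinarith [sq_nonneg (y s)]

lemma exists_isMaxWeightSchedule (E : EGS S) (q : S → ℕ) : ∃ M, E.IsMaxWeightSchedule q M := by
  classical
  have hfin : {M : S → ℕ | E.IsDemandBased q M}.Finite :=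
    (Set.finite_Icc 0 E.x).subset fun M hM => ⟨fun s => Nat.zero_le _, hM.1⟩
  obtain ⟨M, hM, hmax⟩ := hfin.exists_maximalFor (fun M => ∑ s, q s * M s) _
    ⟨0, by simp [IsDemandBased]⟩
  refine ⟨M, hM, fun M' hM' => ?_⟩
  rcases le_total (∑ s, q s * M' s) (∑ s, q s * M s) with h | h
  · exact h
  · exact hmax hM' h

lemma exists_policy_isMaxWeight (E : EGS S) (delayed : Bool) :
    ∃ π : E.Policy, π.IsMaxWeight delayed := by
  choose M hM using E.exists_isMaxWeightSchedule
  exact ⟨⟨fun q h _ => M (observedQueue delayed q h), fun q h _ => (hM _).1.isAllocation,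
    fun _ _ => measurable_const⟩, fun q h _ => hM _⟩

/-! ### Stability of maximum weight scheduling -/

/-- The Euclidean norm of the queue vector. -/
def queueNorm (x : State S) : ℝ :=
  √(∑ s, (x.1 s : ℝ) ^ 2)

lemma queueNorm_nonneg (x : State S) : 0 ≤ queueNorm x := Real.sqrt_nonneg _

lemma queueNorm_sq (x : State S) : queueNorm x ^ 2 = ∑ s, (x.1 s : ℝ) ^ 2 :=
  Real.sq_sqrt (Finset.sum_nonneg fun _ _ => sq_nonneg _)

lemma le_queueNorm (x : State S) (s : S) : (x.1 s : ℝ) ≤ queueNorm x := by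
  refine Real.le_sqrt_of_sq_le ?_
  exact Finset.single_le_sum (f := fun s => (x.1 s : ℝ) ^ 2) (fun _ _ => sq_nonneg _)
    (Finset.mem_univ s)

lemma sum_le_card_mul_queueNorm (x : State S) :
    ∑ s, (x.1 s : ℝ) ≤ Fintype.card S * queueNorm x := by
  rw [← nsmul_eq_mul, ← Finset.card_univ]
  exact Finset.sum_le_card_nsmul _ _ _ fun s _ => le_queueNorm x s

lemma queueNorm_le_sum (x : State S) : queueNorm x ≤ ∑ s, (x.1 s : ℝ) := by
  refine Real.sqrt_le_iff.2 ⟨Finset.sum_nonneg fun _ _ => Nat.cast_nonneg _, ?_⟩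
  exact Finset.sum_sq_le_sq_sum_of_nonneg fun _ _ => Nat.cast_nonneg _

/-- The increment of `queueNorm`, linearized by `√b - √a ≤ (b - a) / (2 √a)`. -/
def normIncrement (x : State S) (M : S → ℕ) (d : E.Draw) : ℝ :=
  (2 * ∑ s, (x.1 s : ℝ) * E.netInput M d s + ∑ s, E.netInput M d s ^ 2) / (2 * queueNorm x)

lemma queueNorm_next_le {x : State S} (hx : 0 < queueNorm x) (M : S → ℕ) (d : E.Draw) :
    queueNorm (next x M d) ≤ queueNorm x + normIncrement x M d := by
  have h1 : queueNorm (next x M d) ^ 2 ≤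
      queueNorm x ^ 2 + 2 * queueNorm x * normIncrement x M d := by
    have h2 : 2 * queueNorm x * normIncrement x M d =
        2 * ∑ s, (x.1 s : ℝ) * E.netInput M d s + ∑ s, E.netInput M d s ^ 2 := by
      rw [normIncrement]
      field_simp
    rw [h2, queueNorm_sq, queueNorm_sq, Finset.mul_sum, ← Finset.sum_add_distrib,
      ← Finset.sum_add_distrib]
    refine Finset.sum_le_sum fun s _ => (next_sq_le x M d s).trans (le_of_eq ?_)
    ring
  have h3 := sq_nonneg (queueNorm (next x M d) - queueNorm x)
  have h4 : 2 * queueNorm x * queueNorm (next x M d) ≤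
      2 * queueNorm x * (queueNorm x + normIncrement x M d) := by nlinarith
  exact le_of_mul_le_mul_left h4 (by positivity)

lemma abs_normIncrement_le {x : State S} (hx : 1 ≤ queueNorm x) (M : S → ℕ) {d : E.Draw}
    (hd : ∀ s, d.1 s ≤ ⌊lam s⌋₊ + 1) :
    |normIncrement x M d| ≤
      Fintype.card S * E.inputBound lam + Fintype.card S * E.inputBound lam ^ 2 := by
  set B := E.inputBound lam
  have hB : 0 ≤ B := zero_le_one.trans (E.one_le_inputBound lam)
  have hD : ∀ s, |E.netInput M d s| ≤ B := fun s => E.abs_netInput_le lam M (hd s)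
  have h1 : |∑ s, (x.1 s : ℝ) * E.netInput M d s| ≤ B * (Fintype.card S * queueNorm x) := by
    calc _ ≤ ∑ s, |(x.1 s : ℝ) * E.netInput M d s| := Finset.abs_sum_le_sum_abs _ _
      _ ≤ ∑ s, B * (x.1 s : ℝ) := by
          refine Finset.sum_le_sum fun s _ => ?_
          rw [abs_mul, Nat.abs_cast, mul_comm]
          exact mul_le_mul_of_nonneg_right (hD s) (Nat.cast_nonneg _)
      _ ≤ _ := by
          rw [← Finset.mul_sum]
          exact mul_le_mul_of_nonneg_left (sum_le_card_mul_queueNorm x) hB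
  have h2 : ∑ s, E.netInput M d s ^ 2 ≤ Fintype.card S * B ^ 2 := by
    rw [← nsmul_eq_mul, ← Finset.card_univ]
    exact Finset.sum_le_card_nsmul _ _ _ fun s _ => sq_le_sq' (abs_le.1 (hD s)).1 (abs_le.1 (hD s)).2
  have h3 : 0 ≤ ∑ s, E.netInput M d s ^ 2 := Finset.sum_nonneg fun _ _ => sq_nonneg _
  have h4 : (Fintype.card S : ℝ) * B ^ 2 ≤ Fintype.card S * B ^ 2 * queueNorm x :=
    le_mul_of_one_le_right (by positivity) hx
  have h5 : 0 ≤ (Fintype.card S : ℝ) * B ^ 2 * queueNorm x := by positivity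
  rw [normIncrement, abs_div, abs_of_pos (show 0 < 2 * queueNorm x by linarith),
    div_le_iff₀ (by linarith)]
  refine (abs_add_le _ _).trans ?_
  rw [abs_mul, abs_two, abs_of_nonneg h3]
  nlinarith

/-- All components of `lam` can be increased by `δ` without leaving the rate set. -/
def HasSlack (E : EGS S) (lam : S → ℝ) (δ : ℝ) : Prop :=
  (∀ s, lam s + δ ≤ E.pgen * E.x s) ∧ ∑ s, (lam s + δ) ≤ E.pgen * E.R

lemma exists_hasSlack (hp : 0 < (E.pgen : ℝ)) {ε : ℝ} (hε : 0 < ε)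
    (h : (1 + ε) • lam ∈ E.rateSet) : ∃ δ, 0 < δ ∧ E.HasSlack lam δ := by
  obtain ⟨-, hR, hx⟩ := h
  simp only [Pi.smul_apply, smul_eq_mul] at hR hx
  rw [← Finset.mul_sum] at hR
  have hN : (0 : ℝ) < Fintype.card S + 1 := by positivity
  -- `(1 + ε) * δ * (card S + 1) = ε * pgen`
  set δ := ε * E.pgen / ((1 + ε) * (Fintype.card S + 1)) with hδ
  have hδ0 : 0 < δ := by positivity
  have hδ1 : (1 + ε) * δ * (Fintype.card S + 1) = ε * E.pgen := by
    rw [hδ]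
    field_simp
  have hδ2 : (1 + ε) * δ ≤ ε * E.pgen := by
    rw [← hδ1]
    exact le_mul_of_one_le_right (by positivity) (by simp)
  have hε1 : 0 < 1 + ε := by linarith
  refine ⟨δ, hδ0, fun s => ?_, ?_⟩
  · have h1 : (1 : ℝ) ≤ E.x s := by exact_mod_cast E.one_le_x s
    have h2 : ε * E.pgen ≤ ε * E.pgen * E.x s := le_mul_of_one_le_right (by positivity) h1
    have h3 := hx s
    refine le_of_mul_le_mul_left ?_ hε1
    nlinarith
  · rw [Finset.sum_add_distrib, Finset.sum_const, nsmul_eq_mul, Finset.card_univ]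
    rcases isEmpty_or_nonempty S with hS | ⟨⟨s⟩⟩
    · simp only [Finset.univ_eq_empty, Finset.sum_empty, Fintype.card_eq_zero, Nat.cast_zero,
        zero_mul, add_zero]
      positivity
    · have h1 : (1 : ℝ) ≤ E.R := by exact_mod_cast (E.one_le_x s).trans (E.x_le_R s)
      have h2 : ε * E.pgen ≤ ε * E.pgen * E.R := le_mul_of_one_le_right (by positivity) h1
      have h3 : (1 + ε) * (Fintype.card S * δ) ≤ ε * E.pgen := by
        rw [← hδ1]
        have : 0 ≤ (1 + ε) * δ := by positivity
        nlinarith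
      refine le_of_mul_le_mul_left ?_ hε1
      nlinarith

/-- The drift of the sum of the squares of the queues under maximum weight scheduling, when the
schedule is computed from a queue vector `q'` near the current one `q`. -/
lemma exists_sum_mul_drift_le (hp : 0 < (E.pgen : ℝ)) (h0 : ∀ s, 0 ≤ lam s) {δ : ℝ} (hδ : 0 < δ)
    (hslack : E.HasSlack lam δ) :
    ∃ K : ℝ, 0 ≤ K ∧ ∀ q q' M : S → ℕ, E.IsMaxWeightSchedule q' M →
      (∀ s, |(q s : ℝ) - q' s| ≤ E.inputBound lam) →
      ∑ s, (q s : ℝ) * (lam s - E.pgen * M s) ≤ -δ * ∑ s, (q s : ℝ) + K := by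
  set y : S → ℝ := fun s => (lam s + δ) / E.pgen
  have hpy : ∀ s, E.pgen * y s = lam s + δ := fun s => mul_div_cancel₀ _ hp.ne'
  have hy0 : ∀ s, 0 ≤ y s := fun s => div_nonneg (add_nonneg (h0 s) hδ.le) hp.le
  have hyx : ∀ s, y s ≤ E.x s := fun s => (div_le_iff₀' hp).2 (hslack.1 s)
  have hyR : ∑ s, y s ≤ E.R := by
    simp only [y]
    rw [← Finset.sum_div]
    exact (div_le_iff₀' hp).2 hslack.2
  set B := E.inputBound lam
  have hB : 0 ≤ B := zero_le_one.trans (E.one_le_inputBound lam)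
  refine ⟨E.pgen * ∑ s, y s ^ 2 + Fintype.card S * (B * (B + δ)), ?_, fun q q' M hM hq => ?_⟩
  · have : 0 ≤ ∑ s, y s ^ 2 := Finset.sum_nonneg fun _ _ => sq_nonneg _
    positivity
  have h1 := mul_le_mul_of_nonneg_left (hM.sum_mul_le hy0 hyx hyR) hp.le
  rw [mul_sub, Finset.mul_sum, Finset.mul_sum (f := fun s => (q' s : ℝ) * M s)] at h1
  have h2 : ∀ s, (q s : ℝ) * (lam s - E.pgen * M s) + δ * q s ≤
      (E.pgen * (q' s * y s) - E.pgen * (q' s * M s)) + B * (B + δ) := by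
    intro s
    have e1 : (E.pgen : ℝ) * (q' s * y s) = q' s * (lam s + δ) := by
      rw [← hpy s]
      ring
    have e2 : |lam s - E.pgen * M s + δ| ≤ B + δ := by
      have hb := E.add_le_inputBound lam s
      have hl := (Nat.lt_floor_add_one (lam s)).le
      have hm : (M s : ℝ) ≤ E.R := by exact_mod_cast hM.1.isAllocation.le_R s
      have hm0 : (0 : ℝ) ≤ M s := Nat.cast_nonneg _
      have hp1 : (E.pgen : ℝ) ≤ 1 := E.pgen.2.2
      have hpm : (E.pgen : ℝ) * M s ≤ E.R := by nlinarith
      have hpm0 : 0 ≤ (E.pgen : ℝ) * M s := by positivity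
      have hf : (0 : ℝ) ≤ ⌊lam s⌋₊ := Nat.cast_nonneg _
      have hR : (0 : ℝ) ≤ E.R := Nat.cast_nonneg _
      have := h0 s
      rw [abs_le]
      constructor <;> linarith
    have e3 : ((q s : ℝ) - q' s) * (lam s - E.pgen * M s + δ) ≤ B * (B + δ) := by
      refine (le_abs_self _).trans ?_
      rw [abs_mul]
      exact mul_le_mul (hq s) e2 (abs_nonneg _) hB
    rw [e1]
    linarith
  have h3 := Finset.sum_le_sum fun s (_ : s ∈ Finset.univ) => h2 s
  rw [Finset.sum_add_distrib, Finset.sum_add_distrib, Finset.sum_sub_distrib, ← Finset.mul_sum,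
    Finset.sum_const, nsmul_eq_mul, Finset.card_univ] at h3
  linarith

lemma integral_normIncrement_le (h0 : ∀ s, 0 ≤ lam s) {x : State S} (hx : 0 < queueNorm x)
    {M : S → ℕ} (hM : E.IsAllocation M) :
    ∫ d, normIncrement x M d ∂(E.drawLaw lam) ≤
      (2 * ∑ s, (x.1 s : ℝ) * (lam s - E.pgen * M s) +
        Fintype.card S * E.inputBound lam ^ 2) / (2 * queueNorm x) := by
  have hsq : ∀ᵐ d ∂(E.drawLaw lam),
      ∑ s, E.netInput M d s ^ 2 ≤ Fintype.card S * E.inputBound lam ^ 2 := by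
    filter_upwards [E.ae_arrivals_le lam] with d hd
    rw [← nsmul_eq_mul, ← Finset.card_univ]
    refine Finset.sum_le_card_nsmul _ _ _ fun s _ => ?_
    have := abs_le.1 (E.abs_netInput_le lam M (hd s))
    exact sq_le_sq' this.1 this.2
  have hint1 : Integrable (fun d => 2 * ∑ s, (x.1 s : ℝ) * E.netInput M d s) (E.drawLaw lam) :=
    (integrable_finsetSum _ fun s _ => (E.integrable_netInput lam M s).const_mul _).const_mul _
  have hint2 : Integrable (fun d => ∑ s, E.netInput M d s ^ 2) (E.drawLaw lam) := by
    refine Integrable.of_bound (measurable_of_countable _).aestronglyMeasurable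
      (Fintype.card S * E.inputBound lam ^ 2) ?_
    filter_upwards [hsq] with d hd
    rwa [Real.norm_of_nonneg (Finset.sum_nonneg fun _ _ => sq_nonneg _)]
  unfold normIncrement
  rw [integral_div, integral_add hint1 hint2, integral_const_mul,
    integral_finsetSum _ fun s _ => (E.integrable_netInput lam M s).const_mul _]
  simp_rw [integral_const_mul, fun s => E.integral_netInput (h0 s) (hM.le_R s)]
  gcongr
  calc _ ≤ ∫ _, (Fintype.card S * E.inputBound lam ^ 2 : ℝ) ∂(E.drawLaw lam) :=
        integral_mono_ae hint2 (integrable_const _) hsq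
    _ = _ := by simp

/-- Far from the origin `exp (θ * queueNorm)` decreases on average by a constant factor, and near
the origin it stays bounded. -/
lemma exists_exp_queueNorm_drift (hp : 0 < (E.pgen : ℝ)) (h0 : ∀ s, 0 ≤ lam s) {δ : ℝ}
    (hδ : 0 < δ) (hslack : E.HasSlack lam δ) :
    ∃ θ : ℝ, 0 < θ ∧ ∃ ρ C : ENNReal, ρ < 1 ∧ C ≠ ⊤ ∧ ∀ (x : State S) (q' M : S → ℕ),
      E.IsMaxWeightSchedule q' M → (∀ s, |(x.1 s : ℝ) - q' s| ≤ E.inputBound lam) →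
      ∫⁻ d, ENNReal.ofReal (Real.exp (θ * queueNorm (next x M d))) ∂(E.drawLaw lam) ≤
        ρ * ENNReal.ofReal (Real.exp (θ * queueNorm x)) + C := by
  obtain ⟨K, hK, hdrift⟩ := exists_sum_mul_drift_le hp h0 hδ hslack
  set B := E.inputBound lam
  have hB : 0 ≤ B := zero_le_one.trans (E.one_le_inputBound lam)
  obtain ⟨θ, hθ, ρ, hρ, hexp⟩ := exists_lintegral_exp_le (E.drawLaw lam)
    (Fintype.card S * B + Fintype.card S * B ^ 2) (half_pos hδ)
  -- beyond `L` the drift `-δ` of the norm dominates the bounded terms, up to a factor of two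
  set L := (2 * K + Fintype.card S * B ^ 2) / δ + 1
  have hL1 : 1 ≤ L := le_add_of_nonneg_left (by positivity)
  refine ⟨θ, hθ, ρ, ENNReal.ofReal (Real.exp (θ * (Fintype.card S * (L + B)))), hρ,
    ENNReal.ofReal_ne_top, fun x q' M hM hq => ?_⟩
  rcases lt_or_ge (queueNorm x) L with hlt | hge
  · refine le_add_left ?_
    calc _ ≤ ∫⁻ _, ENNReal.ofReal (Real.exp (θ * (Fintype.card S * (L + B)))) ∂(E.drawLaw lam) := by
          refine lintegral_mono_ae ?_
          filter_upwards [E.ae_arrivals_le lam] with d hd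
          refine ENNReal.ofReal_le_ofReal (Real.exp_le_exp.2 (mul_le_mul_of_nonneg_left ?_ hθ.le))
          refine (queueNorm_le_sum _).trans ?_
          rw [← nsmul_eq_mul, ← Finset.card_univ]
          refine Finset.sum_le_card_nsmul _ _ _ fun s _ => ?_
          have h1 : ((next x M d).1 s : ℝ) ≤ x.1 s + d.1 s := by exact_mod_cast next_le x M d s
          have h2 : (d.1 s : ℝ) ≤ ⌊lam s⌋₊ + 1 := by exact_mod_cast hd s
          have h3 := E.add_le_inputBound lam s
          have h4 := le_queueNorm x s
          have h5 : (0 : ℝ) ≤ E.R := Nat.cast_nonneg _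
          linarith
      _ = _ := by simp
  · have hx1 : 1 ≤ queueNorm x := hL1.trans hge
    have hx0 : 0 < queueNorm x := zero_lt_one.trans_le hx1
    refine le_add_right ?_
    calc _ ≤ ∫⁻ d, ENNReal.ofReal (Real.exp (θ * queueNorm x)) *
            ENNReal.ofReal (Real.exp (θ * normIncrement x M d)) ∂(E.drawLaw lam) := by
          refine lintegral_mono fun d => ?_
          rw [← ENNReal.ofReal_mul (Real.exp_pos _).le, ← Real.exp_add, ← mul_add]
          exact ENNReal.ofReal_le_ofReal (Real.exp_le_exp.2
            (mul_le_mul_of_nonneg_left (queueNorm_next_le hx0 M d) hθ.le))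
      _ = ENNReal.ofReal (Real.exp (θ * queueNorm x)) *
            ∫⁻ d, ENNReal.ofReal (Real.exp (θ * normIncrement x M d)) ∂(E.drawLaw lam) :=
          lintegral_const_mul _ (measurable_of_countable _)
      _ ≤ ENNReal.ofReal (Real.exp (θ * queueNorm x)) * ρ := by
          gcongr
          refine hexp _ (measurable_of_countable _).aestronglyMeasurable ?_ ?_
          · filter_upwards [E.ae_arrivals_le lam] with d hd
            exact abs_normIncrement_le hx1 M hd
          · refine (integral_normIncrement_le h0 hx0 hM.1.isAllocation).trans ?_
            have h1 := hdrift x.1 q' M hM hq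
            have h2 := mul_le_mul_of_nonneg_left (queueNorm_le_sum x) hδ.le
            have h3 : 2 * K + Fintype.card S * B ^ 2 ≤ δ * queueNorm x := by
              have : (2 * K + Fintype.card S * B ^ 2) / δ ≤ queueNorm x := by
                simp only [L] at hge
                linarith
              rwa [div_le_iff₀' hδ] at this
            rw [div_le_iff₀ (by positivity)]
            nlinarith
      _ = _ := mul_comm _ _

/-- With or without delay, the queue vector used for scheduling is near the current one. -/
lemma abs_sub_observedQueue_le (π : E.Policy) (q₀ : S → ℕ) (delayed : Bool) {ω : ℕ → E.Noise}
    (hω : ∀ n s, (ω n).2.1 s ≤ ⌊lam s⌋₊ + 1) (n : ℕ) (s : S) :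
    |((run π q₀ ω n).1 s : ℝ) -
      observedQueue delayed (run π q₀ ω n).1 (run π q₀ ω n).2 s| ≤ E.inputBound lam := by
  have hB : 0 ≤ E.inputBound lam := zero_le_one.trans (E.one_le_inputBound lam)
  cases delayed with
  | false => simpa [observedQueue] using hB
  | true =>
    cases n with
    | zero => simpa [observedQueue, run] using hB
    | succ n =>
      set x := run π q₀ ω n
      have hobs : observedQueue true (run π q₀ ω (n + 1)).1 (run π q₀ ω (n + 1)).2 s = x.1 s := rfl
      rw [hobs, run_succ, step]
      have h1 : ((next x (π.schedAt x (ω n).1) (ω n).2).1 s : ℝ) ≤ x.1 s + (ω n).2.1 s := by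
        exact_mod_cast next_le _ _ _ _
      have h2 := add_netInput_le_next x (π.schedAt x (ω n).1) (ω n).2 s
      have h3 := abs_le.1 (E.abs_netInput_le lam (π.schedAt x (ω n).1) (hω n s))
      have h4 : ((ω n).2.1 s : ℝ) ≤ ⌊lam s⌋₊ + 1 := by exact_mod_cast hω n s
      have h5 := E.add_le_inputBound lam s
      have h6 : (0 : ℝ) ≤ E.R := Nat.cast_nonneg _
      rw [abs_le]
      constructor <;> linarith

lemma Policy.IsMaxWeight.supports_of_hasSlack {delayed : Bool} {π : E.Policy} (hπ : π.IsMaxWeight delayed)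
    (hp : 0 < (E.pgen : ℝ)) (h0 : ∀ s, 0 ≤ lam s) {δ : ℝ} (hδ : 0 < δ)
    (hslack : E.HasSlack lam δ) : π.Supports lam := by
  intro q₀
  obtain ⟨θ, hθ, ρ, C, hρ, hC, hstep⟩ := exists_exp_queueNorm_drift hp h0 hδ hslack
  set f : State S → ENNReal := fun x => ENNReal.ofReal (Real.exp (θ * queueNorm x)) with hf
  have hmeas : ∀ n, Measurable fun ω => f (run π q₀ ω n) := fun n =>
    (measurable_of_countable f).comp (measurable_run π q₀ n)
  -- the fixed point of `u ↦ ρ u + C`, plus the initial value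
  set D := C * (1 - ρ)⁻¹ + f (q₀, [])
  have hDtop : D ≠ ⊤ := by
    have : (1 - ρ)⁻¹ ≠ ⊤ := ENNReal.inv_ne_top.2 (tsub_pos_of_lt hρ).ne'
    exact ENNReal.add_ne_top.2 ⟨ENNReal.mul_ne_top hC this, ENNReal.ofReal_ne_top⟩
  have hD : ρ * D + C ≤ D := by
    have h1 : C * (1 - ρ)⁻¹ * (1 - ρ) = C := by
      rw [mul_assoc, ENNReal.inv_mul_cancel (tsub_pos_of_lt hρ).ne'
        (ne_top_of_le_ne_top ENNReal.one_ne_top tsub_le_self), mul_one]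
    have h2 : C * (1 - ρ)⁻¹ * ρ + C = C * (1 - ρ)⁻¹ := by
      nth_rw 2 [← h1]
      rw [← mul_add, add_tsub_cancel_of_le hρ.le, mul_one]
    calc ρ * D + C = (C * (1 - ρ)⁻¹ * ρ + C) + ρ * f (q₀, []) := by
          simp only [D]
          ring
      _ ≤ C * (1 - ρ)⁻¹ + 1 * f (q₀, []) := by
          rw [h2]
          gcongr
      _ = D := by rw [one_mul]
  have hbound : ∀ n, ∫⁻ ω, f (run π q₀ ω n) ∂(E.law lam) ≤ D := by
    intro n
    induction n with
    | zero =>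
      simp only [run, lintegral_const, measure_univ, mul_one]
      exact le_add_left le_rfl
    | succ n ih =>
      calc _ ≤ ∫⁻ ω, (ρ * f (run π q₀ ω n) + C) ∂(E.law lam) := by
            refine lintegral_run_succ_le lam π q₀ (g := fun x => ρ * f x + C) ?_
            filter_upwards [ae_forall_arrivals_le (E := E) lam] with ω hω u
            exact hstep _ _ _ (hπ _ _ _) (abs_sub_observedQueue_le π q₀ delayed hω n)
        _ = ρ * ∫⁻ ω, f (run π q₀ ω n) ∂(E.law lam) + C := by
            rw [lintegral_add_right _ measurable_const, lintegral_const_mul _ (hmeas n)]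
            simp
        _ ≤ ρ * D + C := by gcongr
        _ ≤ D := hD
  -- Markov's inequality, with `|q| ≤ N * queueNorm`
  set N : ℝ := Fintype.card S + 1
  have hN : 0 < N := by positivity
  refine stableFrom_of_tail_le
    (f := fun Q => D / ENNReal.ofReal (Real.exp (θ * ((Q : ℝ) / N)))) ?_ fun Q n => ?_
  · have h1 : Tendsto (fun Q : ℕ => θ * ((Q : ℝ) / N)) atTop atTop :=
      (tendsto_natCast_atTop_atTop.atTop_div_const hN).const_mul_atTop hθ
    have h2 : Tendsto (fun Q : ℕ => ENNReal.ofReal (Real.exp (θ * ((Q : ℝ) / N)))) atTop (𝓝 ⊤) :=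
      ENNReal.tendsto_ofReal_atTop.comp (Real.tendsto_exp_atTop.comp h1)
    simpa using ENNReal.Tendsto.const_div h2 (Or.inr hDtop)
  · have hsub : {ω | Q ≤ totalQueue π q₀ ω n} ⊆
        {ω | ENNReal.ofReal (Real.exp (θ * ((Q : ℝ) / N))) ≤ f (run π q₀ ω n)} := by
      intro ω hω
      have h1 : Q ≤ ∑ s, (run π q₀ ω n).1 s := hω
      have h2 : (Q : ℝ) ≤ ∑ s, ((run π q₀ ω n).1 s : ℝ) := by exact_mod_cast h1
      have h3 := sum_le_card_mul_queueNorm (run π q₀ ω n)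
      have h4 := queueNorm_nonneg (run π q₀ ω n)
      refine ENNReal.ofReal_le_ofReal (Real.exp_le_exp.2 (mul_le_mul_of_nonneg_left ?_ hθ.le))
      rw [div_le_iff₀ hN]
      simp only [N]
      linarith
    refine (measure_mono hsub).trans ((meas_ge_le_lintegral_div (hmeas n).aemeasurable
      (ENNReal.ofReal_pos.2 (Real.exp_pos _)).ne' ENNReal.ofReal_ne_top).trans ?_)
    gcongr
    exact hbound n

/-- Without arrivals the queues never exceed their initial values. -/
lemma supports_zero (π : E.Policy) : π.Supports (0 : S → ℝ) := by
  intro q₀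
  have hzero : ∀ᵐ d ∂(E.drawLaw 0), ∀ s, d.1 s = 0 := by
    rw [ae_all_iff]
    intro s
    have h : MeasurePreserving (fun d : E.Draw => d.1 s) (E.drawLaw 0) (arrivalLaw 0) :=
      (measurePreserving_eval (fun _ => arrivalLaw 0) s).comp measurePreserving_fst
    refine h.quasiMeasurePreserving.ae (p := fun k => k = 0) ?_
    have : arrivalLaw 0 = Measure.dirac 0 := by
      have h0 : (⟨Int.fract (0 : ℝ), Int.fract_nonneg 0, (Int.fract_lt_one 0).le⟩ : unitInterval)
          = 0 := by
        ext
        simp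
      rw [arrivalLaw, h0]
      simp
    rw [this, ae_dirac_eq]
    rfl
  have hall : ∀ᵐ ω ∂(E.law 0), ∀ n s, (ω n).2.1 s = 0 := by
    rw [ae_all_iff]
    intro n
    have h : MeasurePreserving (fun ω : ℕ → E.Noise => (ω n).2) (E.law 0) (E.drawLaw 0) :=
      measurePreserving_snd.comp (measurePreserving_eval_infinitePi (fun _ => E.slotLaw 0) n)
    exact h.quasiMeasurePreserving.ae hzero
  have hle : ∀ᵐ ω ∂(E.law 0), ∀ n, totalQueue π q₀ ω n ≤ ∑ s, q₀ s := by
    filter_upwards [hall] with ω hω n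
    refine Finset.sum_le_sum fun s _ => ?_
    induction n with
    | zero => exact le_rfl
    | succ n ih =>
      rw [run_succ, step]
      refine (next_le _ _ _ s).trans ?_
      rw [hω n s]
      exact ih
  refine stableFrom_of_tail_le (f := fun Q => if Q ≤ ∑ s, q₀ s then 1 else 0) ?_ fun Q n => ?_
  · refine tendsto_const_nhds.congr' ?_
    filter_upwards [eventually_gt_atTop (∑ s, q₀ s)] with Q hQ
    rw [if_neg (not_le.2 hQ)]
  · split_ifs with hQ
    · exact prob_le_one
    · rw [nonpos_iff_eq_zero, ← compl_mem_ae_iff]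
      filter_upwards [hle] with ω hω h
      exact hQ (le_trans h (hω n))

theorem Policy.IsMaxWeight.supports {delayed : Bool} {π : E.Policy} (hπ : π.IsMaxWeight delayed) {ε : ℝ}
    (hε : 0 < ε) (h : (1 + ε) • lam ∈ E.rateSet) : π.Supports lam := by
  have hε1 : 0 < 1 + ε := by linarith
  have h0 : ∀ s, 0 ≤ lam s := fun s => nonneg_of_mul_nonneg_right (h.1 s) hε1
  rcases E.pgen.2.1.eq_or_lt with hp | hp
  · have : lam = 0 := by
      funext s
      have h1 := h.2.2 s
      rw [← hp, mul_zero] at h1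
      exact le_antisymm (nonpos_of_mul_nonpos_right h1 hε1) (h0 s)
    rw [this]
    exact supports_zero π
  · obtain ⟨δ, hδ, hslack⟩ := exists_hasSlack hp hε h
    exact hπ.supports_of_hasSlack hp h0 hδ hslack

/-! ### The interior of the rate set -/

lemma exists_one_add_smul_mem (h : lam ∈ interior E.rateSet) :
    ∃ ε : ℝ, 0 < ε ∧ (1 + ε) • lam ∈ E.rateSet := by
  have hc : Tendsto (fun ε : ℝ => (1 + ε) • lam) (𝓝[>] 0) (𝓝 lam) := by
    have : Continuous fun ε : ℝ => (1 + ε) • lam := by fun_prop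
    simpa using (this.tendsto 0).mono_left nhdsWithin_le_nhds
  have h1 := hc.eventually (mem_interior_iff_mem_nhds.1 h)
  obtain ⟨ε, h2, h3⟩ := (h1.and self_mem_nhdsWithin).exists
  exact ⟨ε, h3, h2⟩

lemma pos_of_mem_interior (h : lam ∈ interior E.rateSet) (s : S) : 0 < lam s := by
  have hc : Tendsto (fun ε : ℝ => lam - ε • (1 : S → ℝ)) (𝓝[>] 0) (𝓝 lam) := by
    have : Continuous fun ε : ℝ => lam - ε • (1 : S → ℝ) := by fun_prop
    simpa using (this.tendsto 0).mono_left nhdsWithin_le_nhds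
  have h1 := hc.eventually (mem_interior_iff_mem_nhds.1 h)
  obtain ⟨ε, h2, h3⟩ := (h1.and self_mem_nhdsWithin).exists
  have h4 : 0 ≤ lam s - ε * 1 := h2.1 s
  have h5 : 0 < ε := h3
  linarith

/-- A positive rate vector in the rate set but not in its interior puts load exactly one on some
bottleneck. -/
lemma exists_isBottleneck_eq (h0 : ∀ s, 0 < lam s) (h : lam ∈ E.rateSet)
    (hint : lam ∉ interior E.rateSet) :
    ∃ T c, E.IsBottleneck T c ∧ ∑ s ∈ T, lam s = E.pgen * c := by
  rcases isEmpty_or_nonempty S with hS | hS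
  · refine absurd ?_ hint
    have : E.rateSet = Set.univ := Set.eq_univ_of_forall fun v => Subsingleton.elim lam v ▸ h
    simp [this]
  by_contra! hne
  refine hint (mem_interior.2 ⟨{v | (∀ s, 0 < v s) ∧ ∑ s, v s < E.R * (E.pgen : ℝ) ∧
    ∀ s, v s < E.x s * (E.pgen : ℝ)}, ?_, ?_, h0, ?_, fun s => ?_⟩)
  · exact fun v hv => ⟨fun s => (hv.1 s).le, hv.2.1.le, fun s => (hv.2.2 s).le⟩
  · simp only [Set.ofPred_and, Set.ofPred_forall]
    refine (isOpen_iInter_of_finite fun s => ?_).inter (IsOpen.inter ?_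
      (isOpen_iInter_of_finite fun s => ?_))
    · exact isOpen_lt continuous_const (continuous_apply s)
    · exact isOpen_lt (by fun_prop) continuous_const
    · exact isOpen_lt (continuous_apply s) continuous_const
  · refine lt_of_le_of_ne h.2.1 ?_
    rw [mul_comm]
    exact hne _ _ E.isBottleneck_univ
  · refine lt_of_le_of_ne (h.2.2 s) ?_
    rw [mul_comm]
    simpa using hne _ _ (E.isBottleneck_singleton s)

lemma capacityRegion_eq_interior (hp1 : E.pgen < 1) :
    E.capacityRegion = interior E.rateSet := by
  ext lam
  constructor
  · rintro ⟨h0, π, hπ⟩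
    have h0' : ∀ s, 0 ≤ lam s := fun s => (h0 s).le
    by_contra hint
    by_cases hmem : lam ∈ E.rateSet
    · obtain ⟨T, c, hT, heq⟩ := exists_isBottleneck_eq h0 hmem hint
      have hp0 : (0 : ℝ) < E.pgen := by
        have h1 : 0 < ∑ s ∈ T, lam s := Finset.sum_pos (fun s _ => h0 s) hT.1
        rw [heq] at h1
        exact pos_of_mul_pos_left h1 (Nat.cast_nonneg c)
      exact not_stableFrom_of_isBottleneck_eq hp0 hp1 h0' hT heq π 0 (hπ 0)
    · obtain ⟨T, c, hT, hlt⟩ := exists_isBottleneck_lt h0' hmem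
      exact not_stableFrom_of_ae_tendsto (ae_tendsto_of_isBottleneck_lt h0' hT hlt π 0) (hπ 0)
  · intro h
    obtain ⟨π, hπ⟩ := E.exists_policy_isMaxWeight false
    obtain ⟨ε, hε, hmem⟩ := exists_one_add_smul_mem h
    exact ⟨pos_of_mem_interior h, π, hπ.supports hε hmem⟩

end

end EGS

end

theorem theorem1 {S : Type*} [Fintype S] (E : EGS S) :
    -- the capacity region is the interior of `𝒞`
    (E.pgen < 1 → E.capacityRegion = interior E.rateSet) ∧
    -- outside `𝒞` the queues diverge almost surely, under every policy
    (∀ lam : S → ℝ, (∀ s, 0 ≤ lam s) → lam ∉ E.rateSet →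
      ∀ (π : E.Policy) (q₀ : S → ℕ),
        (∀ᵐ ω ∂(E.law lam), Tendsto (EGS.totalQueue π q₀ ω) atTop atTop) ∧
        ¬ EGS.StableFrom π lam q₀) ∧
    -- maximum weight scheduling, for either timing of the queue observation
    (∀ delayed : Bool,
      (∃ π : E.Policy, π.IsMaxWeight delayed) ∧
      ∀ π : E.Policy, π.IsMaxWeight delayed →
        (∀ lam : S → ℝ, (∃ ε : ℝ, 0 < ε ∧ (1 + ε) • lam ∈ E.rateSet) → π.Supports lam) ∧
        (∀ lam ∈ interior E.rateSet, π.Supports lam) ∧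
        (E.pgen < 1 → π.IsThroughputOptimal)) := by
  refine ⟨EGS.capacityRegion_eq_interior, fun lam h0 hmem π q₀ => ?_, fun delayed => ?_⟩
  · obtain ⟨T, c, hT, hlt⟩ := EGS.exists_isBottleneck_lt h0 hmem
    have h := EGS.ae_tendsto_of_isBottleneck_lt h0 hT hlt π q₀
    exact ⟨h, EGS.not_stableFrom_of_ae_tendsto h⟩
  · refine ⟨E.exists_policy_isMaxWeight delayed, fun π hπ => ?_⟩
    have hsup : ∀ lam : S → ℝ, (∃ ε : ℝ, 0 < ε ∧ (1 + ε) • lam ∈ E.rateSet) → π.Supports lam :=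
      fun lam ⟨ε, hε, h⟩ => hπ.supports hε h
    have hint : ∀ lam ∈ interior E.rateSet, π.Supports lam :=
      fun lam h => hsup lam (EGS.exists_one_add_smul_mem h)
    refine ⟨hsup, hint, fun hp1 lam h => hint lam ?_⟩
    rwa [EGS.capacityRegion_eq_interior hp1] at h
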